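/- Let $n\ge 2$ and let $(M,g,J)$ be a compact connected Kähler manifold of real dimension $2n$, with Levi-Civita connection $\nabla$. Let $S$ be a $J$-invariant Killing tensor on $M$, i.e. a smooth $g$-symmetric $(1,1)$-tensor field with $SJ=JS$ and $$g((\nabla_X S)Y,Z)+g((\nabla_Z S)X,Y)+g((\nabla_Y S)Z,X)=0\qquad\text{for all } X,Y,Z\in TM .$$ Suppose that $S$ has two eigenvalues $0$ and $\mu$, where $\mu:M\to\mathbb R$ is a non-constant function: at every $x\in M$ each eigenvalue of $S_x$ is $0$ or $\mu(x)$, and wherever $\mu(x)\neq 0$ one has $\dim\ker S_x=2$ and $\dim\ker(S_x-\mu(x)I)=2n-2$. Then the set $$V=\{x\in M:\ \mu(x)\ne 0,\ d\mu(x)\neq 0\}$$ is connected, and its complement $M\setminus V$ has empty interior in $M$. -/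

import Mathlib

open Bundle Set
open scoped Manifold ContDiff

namespace KahlerKilling

section

variable {E : Type*} [NormedAddCommGroup E] [NormedSpace ℝ E] [FiniteDimensional ℝ E]
  {H : Type*} [TopologicalSpace H] {I : ModelWithCorners ℝ E H}
  {M : Type*} [TopologicalSpace M] [ChartedSpace H M] [IsManifold I ∞ M]

/-- A smooth field of endomorphisms of the tangent bundle, i.e. a smooth `(1,1)`-tensor field. -/
def IsSmoothEndField (A : Π x : M, TangentSpace I x →L[ℝ] TangentSpace I x) : Prop :=
  ContMDiff I (I.prod 𝓘(ℝ, E →L[ℝ] E)) ∞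
    (fun x ↦ (⟨x, A x⟩ : TotalSpace (E →L[ℝ] E)
      (fun y : M ↦ TangentSpace I y →L[ℝ] TangentSpace I y)))

/-- The covariant derivative of a field `A` of endomorphisms of the tangent bundle:
`(∇_v A) Y = ∇_v (A Y) - A (∇_v Y)`, for a tangent vector `v` at `x` and a vector field `Y`. -/
noncomputable def covDerivEnd (nabla : CovariantDerivative I E (TangentSpace I : M → Type _))
    (A : Π x : M, TangentSpace I x →L[ℝ] TangentSpace I x)
    (x : M) (v : TangentSpace I x) (Y : Π y : M, TangentSpace I y) : TangentSpace I x :=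
  nabla (fun y ↦ A y (Y y)) x v - A x (nabla Y x v)

variable [RiemannianBundle (fun x : M ↦ TangentSpace I x)]
  [IsContMDiffRiemannianBundle I ∞ E (fun x : M ↦ TangentSpace I x)]

/-- `nabla` is the Levi-Civita connection of the Riemannian manifold `M`: the connection on the
tangent bundle which is torsion-free, `∇_X Y - ∇_Y X = [X, Y]`, and compatible with the metric,
`v (g(Y, Z)) = g(∇_v Y, Z) + g(Y, ∇_v Z)`. -/
structure IsLeviCivita (nabla : CovariantDerivative I E (TangentSpace I : M → Type _)) : Prop where
  torsion_eq_zero : ∀ (x : M) (X Y : Π y : M, TangentSpace I y),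
    MDiffAt (T% X) x → MDiffAt (T% Y) x →
    nabla Y x (X x) - nabla X x (Y x) = VectorField.mlieBracket I X Y x
  metric : ∀ (x : M) (v : TangentSpace I x) (Y Z : Π y : M, TangentSpace I y),
    MDiffAt (T% Y) x → MDiffAt (T% Z) x →
    mfderiv I 𝓘(ℝ) (fun y ↦ inner ℝ (Y y) (Z y)) x v
      = inner ℝ (nabla Y x v) (Z x) + inner ℝ (Y x) (nabla Z x v)

/-- `J` is a Kähler structure on the Riemannian manifold `M` with Levi-Civita connection `nabla`:
a smooth almost complex structure which is orthogonal for the metric and parallel. -/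
structure IsKahler (nabla : CovariantDerivative I E (TangentSpace I : M → Type _))
    (J : Π x : M, TangentSpace I x →L[ℝ] TangentSpace I x) : Prop where
  smooth : IsSmoothEndField J
  sq : ∀ (x : M) (v : TangentSpace I x), J x (J x v) = -v
  orthogonal : ∀ (x : M) (v w : TangentSpace I x), inner ℝ (J x v) (J x w) = inner ℝ v w
  parallel : ∀ (x : M) (v : TangentSpace I x) (Y : Π y : M, TangentSpace I y),
    MDiffAt (T% Y) x → covDerivEnd nabla J x v Y = 0

/-- `S` is a Killing tensor on the Riemannian manifold `M` with Levi-Civita connection `nabla`: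
a smooth symmetric `(1,1)`-tensor field with
`g((∇_X S) Y, Z) + g((∇_Z S) X, Y) + g((∇_Y S) Z, X) = 0`. -/
structure IsKillingTensor (nabla : CovariantDerivative I E (TangentSpace I : M → Type _))
    (S : Π x : M, TangentSpace I x →L[ℝ] TangentSpace I x) : Prop where
  smooth : IsSmoothEndField S
  symm : ∀ (x : M) (v w : TangentSpace I x), inner ℝ (S x v) w = inner ℝ v (S x w)
  cyclic : ∀ (x : M) (X Y Z : Π y : M, TangentSpace I y),
    MDiffAt (T% X) x → MDiffAt (T% Y) x → MDiffAt (T% Z) x →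
    inner ℝ (covDerivEnd nabla S x (X x) Y) (Z x)
      + inner ℝ (covDerivEnd nabla S x (Z x) X) (Y x)
      + inner ℝ (covDerivEnd nabla S x (Y x) Z) (X x) = 0

/-- The field `S` of endomorphisms has the eigenvalues `0` and `μ`: at every point `x` each
eigenvalue of `S x` is `0` or `μ x`, and wherever `μ x ≠ 0` the eigenvalues `0` and `μ x` have
multiplicities `2` and `m`. -/
structure HasEigenvaluesZeroAnd (S : Π x : M, TangentSpace I x →L[ℝ] TangentSpace I x)
    (μ : M → ℝ) (m : ℕ) : Prop where
  eigenvalue : ∀ (x : M) (c : ℝ),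
    Module.End.HasEigenvalue (S x : TangentSpace I x →ₗ[ℝ] TangentSpace I x) c → c = 0 ∨ c = μ x
  finrank_ker : ∀ x : M, μ x ≠ 0 →
    Module.finrank ℝ (LinearMap.ker (S x : TangentSpace I x →ₗ[ℝ] TangentSpace I x)) = 2
  finrank_eigenspace : ∀ x : M, μ x ≠ 0 →
    Module.finrank ℝ
      (Module.End.eigenspace (S x : TangentSpace I x →ₗ[ℝ] TangentSpace I x) (μ x)) = m

variable (I) in
/-- The set of points at which neither `μ` nor its differential vanishes. -/
def regularSet (μ : M → ℝ) : Set M :=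
  {x | μ x ≠ 0 ∧ mfderiv I 𝓘(ℝ) μ x ≠ 0}

end

end KahlerKilling

/-!
The statement is local up to a connectedness argument. Read in a chart, the data are a metric `g`,
a parallel orthogonal complex structure `J`, a symmetric endomorphism field `S` commuting with `J`,
and the Christoffel symbols `Γ`; since `S` is diagonalizable with eigenvalues `0` and `μ`, it
satisfies `S² = μ S` and `tr S = (dim - 2) μ`, so that `μ` is smooth. This is `KillingChart`, and
`killingChart` produces it from the global data.

Write `K` for the gradient of `μ` and call a point regular if `dμ ≠ 0` there. The cyclic identity
on a single eigenvector gives `dμ ∘ S = 0` (`dmu_S`), and together with the second derivative of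
`S² = μ S` it gives `dμ = 0` at the zeros of `μ` (`dmu_eq_zero_of_mu_eq_zero`). Hence the regular
points form exactly the set in question, and over them `ker S` is spanned by `K` and `J K`.

The key fact is that `J K` is a Killing field near regular points (`lieDerivMetric_J_gradient`),
that is, the Hessian of `μ` is `J`-invariant. On the `μ`-eigenspaces the Killing equation for `S`
computes the Hessian as `|dμ|² / (2μ) g` (`hess_S`). On the span of `K` and `J K` one uses that
brackets of `μ`-eigenvector fields have components along `J K` (`exists_bracket`): functions
constant along the `μ`-eigenspaces, such as `|dμ|²`, are then constant along `J K`, so that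
`Hess(J K, K) = 0`. The remaining equality `Hess(J K, J K) = Hess(K, K)` comes from the 2-form
`d(-dμ ∘ J) - (|dμ|² / μ) ω`, which vanishes on `μ`-eigenvectors, by evaluating its exterior
derivative on `K` and two `μ`-eigenvectors.

A Killing field is determined along a segment by its 1-jet at one point, by Grönwall's inequality.
By continuity this holds on the closure of the regular points (`exists_unique_continuation`), which
shows that this closure is open (`mem_interior_closure`) and that the second derivative of `μ` does
not vanish at the critical points in it (`fderiv_fderiv_ne_zero`). Being `J`-invariant, this second
derivative has rank at least two, so near such a point all critical points lie in a submanifold of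
codimension two, and the regular points contain a connected dense subset of a neighbourhood
(`exists_isPreconnected_regular`). As `μ` is not constant there are regular points, and the
topological lemma `isConnected_and_dense_of_locally` concludes.
-/

namespace KahlerKilling

set_option linter.unusedSectionVars false
set_option maxSynthPendingDepth 3

/-! ### A Killing tensor in a chart -/

section LocalCalculus

open Filter Topology Module

variable {E : Type*} [NormedAddCommGroup E] [NormedSpace ℝ E] [FiniteDimensional ℝ E]

/-- The data of a `J`-invariant Killing tensor with eigenvalues `0` and `μ` read in a chart with
domain `Ω`: the metric `g`, the complex structure `J`, the Killing tensor `S`, its eigenvalue `μ`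
and the Christoffel symbols `Γ`. The Christoffel symbols are only evaluated pointwise, so no
regularity of `Γ` is recorded. -/
structure KillingChart (Ω : Set E) (g : E → E →L[ℝ] E →L[ℝ] ℝ) (J S : E → E →L[ℝ] E) (μ : E → ℝ)
    (Γ : E → E →ₗ[ℝ] E →ₗ[ℝ] E) : Prop where
  isOpen : IsOpen Ω
  two_lt : 2 < finrank ℝ E
  contDiffOn_g : ContDiffOn ℝ ∞ g Ω
  contDiffOn_J : ContDiffOn ℝ ∞ J Ω
  contDiffOn_S : ContDiffOn ℝ ∞ S Ω
  g_symm : ∀ x ∈ Ω, ∀ v w, g x v w = g x w v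
  g_pos : ∀ x ∈ Ω, ∀ v, v ≠ 0 → 0 < g x v v
  J_sq : ∀ x ∈ Ω, ∀ v, J x (J x v) = -v
  J_orth : ∀ x ∈ Ω, ∀ v w, g x (J x v) (J x w) = g x v w
  S_symm : ∀ x ∈ Ω, ∀ v w, g x (S x v) w = g x v (S x w)
  S_comm : ∀ x ∈ Ω, ∀ v, S x (J x v) = J x (S x v)
  S_sq : ∀ x ∈ Ω, ∀ v, S x (S x v) = μ x • S x v
  trace_S : ∀ x ∈ Ω, LinearMap.trace ℝ E (S x) = ((finrank ℝ E : ℝ) - 2) * μ x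
  finrank_ker : ∀ x ∈ Ω, μ x ≠ 0 → finrank ℝ (LinearMap.ker (S x : E →ₗ[ℝ] E)) = 2
  Γ_symm : ∀ x ∈ Ω, ∀ v w, Γ x v w = Γ x w v
  fderiv_g : ∀ x ∈ Ω, ∀ v a b, fderiv ℝ g x v a b = g x (Γ x v a) b + g x a (Γ x v b)
  fderiv_J : ∀ x ∈ Ω, ∀ v a, fderiv ℝ J x v a = J x (Γ x v a) - Γ x v (J x a)
  cyclic : ∀ x ∈ Ω, ∀ u v w,
    g x (fderiv ℝ S x u v + Γ x u (S x v) - S x (Γ x u v)) w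
      + g x (fderiv ℝ S x w u + Γ x w (S x u) - S x (Γ x w u)) v
      + g x (fderiv ℝ S x v w + Γ x v (S x w) - S x (Γ x v w)) u = 0

/-- The covariant derivative `(∇_v S) a` of the endomorphism field `S` in a chart. -/
noncomputable def covS (S : E → E →L[ℝ] E) (Γ : E → E →ₗ[ℝ] E →ₗ[ℝ] E) (x v a : E) : E :=
  fderiv ℝ S x v a + Γ x v (S x a) - S x (Γ x v a)

/-- The Hessian `(∇ dμ)(v, w)` in a chart. -/
noncomputable def hess (μ : E → ℝ) (Γ : E → E →ₗ[ℝ] E →ₗ[ℝ] E) (x v w : E) : ℝ :=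
  fderiv ℝ (fderiv ℝ μ) x v w - fderiv ℝ μ x (Γ x v w)

/-- The gradient of `μ` with respect to the metric `g`. -/
noncomputable def gradient (g : E → E →L[ℝ] E →L[ℝ] ℝ) (μ : E → ℝ) (x : E) : E :=
  (g x).inverse (fderiv ℝ μ x)

omit [FiniteDimensional ℝ E] in
lemma fderiv_clm_apply_apply {F G : Type*} [NormedAddCommGroup F] [NormedSpace ℝ F]
    [NormedAddCommGroup G] [NormedSpace ℝ G] {A : E → F →L[ℝ] G} {f : E → F} {x : E}
    (hA : DifferentiableAt ℝ A x) (hf : DifferentiableAt ℝ f x) (v : E) :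
    fderiv ℝ (fun z ↦ A z (f z)) x v = fderiv ℝ A x v (f x) + A x (fderiv ℝ f x v) := by
  rw [fderiv_clm_apply hA hf]
  simp [add_comm]

omit [FiniteDimensional ℝ E] in
lemma differentiableAt_flip {A : E → E →L[ℝ] E →L[ℝ] ℝ} {x : E} (dA : DifferentiableAt ℝ A x) :
    DifferentiableAt ℝ (fun z ↦ (A z).flip) x := by
  have hb : IsBoundedLinearMap ℝ (fun B : E →L[ℝ] E →L[ℝ] ℝ ↦ B.flip) :=
    IsLinearMap.with_bound ⟨fun _ _ ↦ rfl, fun _ _ ↦ rfl⟩ 1 fun B ↦ by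
      rw [ContinuousLinearMap.opNorm_flip, one_mul]
  have d := IsBoundedLinearMap.differentiableAt (𝕜 := ℝ) (E := E →L[ℝ] E →L[ℝ] ℝ)
    (F := E →L[ℝ] E →L[ℝ] ℝ) (x := A x) hb
  exact DifferentiableAt.comp (𝕜 := ℝ) (E := E) (F := E →L[ℝ] E →L[ℝ] ℝ)
    (G := E →L[ℝ] E →L[ℝ] ℝ) x d dA

/-- The Lie derivative of the metric `g` along the vector field `ξ`, in a chart. -/
noncomputable def lieDerivMetric (g : E → E →L[ℝ] E →L[ℝ] ℝ) (ξ : E → E) (x v w : E) : ℝ :=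
  fderiv ℝ g x (ξ x) v w + g x (fderiv ℝ ξ x v) w + g x v (fderiv ℝ ξ x w)

/-- The 1-form `-dμ ∘ J`, dual to the rotated gradient `J K`. -/
noncomputable def conjDiff (J : E → E →L[ℝ] E) (μ : E → ℝ) (x : E) : E →L[ℝ] ℝ :=
  -(fderiv ℝ μ x ∘L J x)

/-- The 2-form `d(-dμ ∘ J) - (|dμ|² / μ) ω`, where `ω = g(J·, ·)` is the Kähler form. -/
noncomputable def defectForm (g : E → E →L[ℝ] E →L[ℝ] ℝ) (J : E → E →L[ℝ] E) (μ : E → ℝ) (x : E) :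
    E →L[ℝ] E →L[ℝ] ℝ :=
  fderiv ℝ (conjDiff J μ) x - (fderiv ℝ (conjDiff J μ) x).flip
    - (fderiv ℝ μ x (gradient g μ x) / μ x) • (g x ∘L J x)

omit [FiniteDimensional ℝ E] in
lemma differentiableAt_smul {F : Type*} [NormedAddCommGroup F] [NormedSpace ℝ F] {c : E → ℝ}
    {f : E → F} {x : E} (hc : DifferentiableAt ℝ c x) (hf : DifferentiableAt ℝ f x) :
    DifferentiableAt ℝ (fun z ↦ c z • f z) x := hc.smul hf

namespace KillingChart

variable {Ω : Set E} {g : E → E →L[ℝ] E →L[ℝ] ℝ} {J S : E → E →L[ℝ] E} {μ : E → ℝ}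
  {Γ : E → E →ₗ[ℝ] E →ₗ[ℝ] E} (h : KillingChart Ω g J S μ Γ) {x : E} (hx : x ∈ Ω)

include h hx

lemma mem_nhds : ∀ᶠ z in 𝓝 x, z ∈ Ω := h.isOpen.mem_nhds hx

lemma contDiffAt_g : ContDiffAt ℝ ∞ g x := h.contDiffOn_g.contDiffAt (h.isOpen.mem_nhds hx)
lemma contDiffAt_J : ContDiffAt ℝ ∞ J x := h.contDiffOn_J.contDiffAt (h.isOpen.mem_nhds hx)
lemma contDiffAt_S : ContDiffAt ℝ ∞ S x := h.contDiffOn_S.contDiffAt (h.isOpen.mem_nhds hx)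
lemma diff_g : DifferentiableAt ℝ g x := (h.contDiffAt_g hx).differentiableAt (by simp)
lemma diff_J : DifferentiableAt ℝ J x := (h.contDiffAt_J hx).differentiableAt (by simp)
lemma diff_S : DifferentiableAt ℝ S x := (h.contDiffAt_S hx).differentiableAt (by simp)

lemma eventually_mu_eq :
    μ =ᶠ[𝓝 x] fun z ↦ ((finrank ℝ E : ℝ) - 2)⁻¹ *
      LinearMap.toContinuousLinearMap
        ((LinearMap.trace ℝ E) ∘ₗ (ContinuousLinearMap.coeLM ℝ : (E →L[ℝ] E) →ₗ[ℝ] _)) (S z) := by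
  filter_upwards [h.mem_nhds hx] with z hz
  have h2 : (2 : ℝ) < finrank ℝ E := by exact_mod_cast h.two_lt
  simp only [LinearMap.coe_toContinuousLinearMap', LinearMap.comp_apply,
    ContinuousLinearMap.coeLM_apply]
  rw [h.trace_S z hz, inv_mul_cancel_left₀ (by linarith)]

lemma contDiffAt_mu : ContDiffAt ℝ ∞ μ x :=
  (contDiffAt_const.mul ((ContinuousLinearMap.contDiff _).contDiffAt.comp x
    (h.contDiffAt_S hx))).congr_of_eventuallyEq (h.eventually_mu_eq hx)

lemma diff_mu : DifferentiableAt ℝ μ x := (h.contDiffAt_mu hx).differentiableAt (by simp)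

lemma contDiffAt_dmu : ContDiffAt ℝ ∞ (fderiv ℝ μ) x :=
  (h.contDiffAt_mu hx).fderiv_right (by simp)

lemma diff_dmu : DifferentiableAt ℝ (fderiv ℝ μ) x :=
  (h.contDiffAt_dmu hx).differentiableAt (by simp)

/-! ### Covariant derivative of `S` -/

lemma covS_symm (v a b : E) : g x (covS S Γ x v a) b = g x a (covS S Γ x v b) := by
  have e : (fun z ↦ g z (S z a) b) =ᶠ[𝓝 x] fun z ↦ g z a (S z b) := by
    filter_upwards [h.mem_nhds hx] with z hz using h.S_symm z hz a b
  have e2 := congrArg (fun L : E →L[ℝ] ℝ ↦ L v) e.fderiv_eq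
  have dg := h.diff_g hx
  have dS := h.diff_S hx
  have c (c : E) : DifferentiableAt ℝ (fun _ : E ↦ c) x := differentiableAt_const c
  simp only [fderiv_clm_apply_apply (dg.clm_apply (dS.clm_apply (c a))) (c b),
    fderiv_clm_apply_apply dg (dS.clm_apply (c a)), fderiv_clm_apply_apply dS (c a),
    fderiv_clm_apply_apply (dg.clm_apply (c a)) (dS.clm_apply (c b)),
    fderiv_clm_apply_apply dg (c a), fderiv_clm_apply_apply dS (c b), fderiv_fun_const,
    Pi.zero_apply, _root_.zero_apply, map_zero, add_zero,
    _root_.add_apply, h.fderiv_g x hx] at e2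
  simp only [covS, map_add, map_sub, _root_.add_apply, _root_.sub_apply] at e2 ⊢
  linarith [h.S_symm x hx (Γ x v a) b, h.S_symm x hx a (Γ x v b)]

lemma covS_J (v a : E) : covS S Γ x v (J x a) = J x (covS S Γ x v a) := by
  have e : (fun z ↦ S z (J z a)) =ᶠ[𝓝 x] fun z ↦ J z (S z a) := by
    filter_upwards [h.mem_nhds hx] with z hz using h.S_comm z hz a
  have e2 := congrArg (fun L : E →L[ℝ] E ↦ L v) e.fderiv_eq
  have dJ := h.diff_J hx
  have dS := h.diff_S hx
  have c (c : E) : DifferentiableAt ℝ (fun _ : E ↦ c) x := differentiableAt_const c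
  simp only [fderiv_clm_apply_apply dS (dJ.clm_apply (c a)), fderiv_clm_apply_apply dS (c a),
    fderiv_clm_apply_apply dJ (dS.clm_apply (c a)), fderiv_clm_apply_apply dJ (c a),
    fderiv_fun_const, Pi.zero_apply, _root_.zero_apply, map_zero, add_zero,
    h.fderiv_J x hx] at e2
  simp only [covS, map_add, map_sub, h.S_comm x hx] at e2 ⊢
  rw [← sub_eq_zero] at e2 ⊢
  rw [← e2]
  abel

lemma covS_S (v a : E) : covS S Γ x v (S x a) + S x (covS S Γ x v a)
    = fderiv ℝ μ x v • S x a + μ x • covS S Γ x v a := by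
  have e : (fun z ↦ S z (S z a)) =ᶠ[𝓝 x] fun z ↦ μ z • S z a := by
    filter_upwards [h.mem_nhds hx] with z hz using h.S_sq z hz a
  have e2 := congrArg (fun L : E →L[ℝ] E ↦ L v) e.fderiv_eq
  have dS := h.diff_S hx
  have c (c : E) : DifferentiableAt ℝ (fun _ : E ↦ c) x := differentiableAt_const c
  simp only [fderiv_clm_apply_apply dS (dS.clm_apply (c a)), fderiv_clm_apply_apply dS (c a),
    fderiv_fun_smul (h.diff_mu hx) (dS.clm_apply (c a)), fderiv_fun_const,
    Pi.zero_apply, _root_.zero_apply, map_zero, add_zero,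
    _root_.add_apply, _root_.smul_apply,
    ContinuousLinearMap.smulRight_apply] at e2
  simp only [covS, map_add, map_sub, h.S_sq x hx, map_smul] at e2 ⊢
  rw [← sub_eq_zero] at e2 ⊢
  rw [← e2]
  simp only [smul_add, smul_sub]
  abel

lemma covS_cyclic (u v w : E) : g x (covS S Γ x u v) w + g x (covS S Γ x w u) v
    + g x (covS S Γ x v w) u = 0 := h.cyclic x hx u v w

lemma hess_symm (v w : E) : hess μ Γ x v w = hess μ Γ x w v := by
  have := ((h.contDiffAt_mu hx).isSymmSndFDerivAt
    (by rw [minSmoothness_of_isRCLikeNormedField]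
        exact WithTop.coe_le_coe.2 (le_top : (2 : ℕ∞) ≤ ⊤))).eq v w
  rw [hess, hess, this, h.Γ_symm x hx]

lemma g_eq_zero {v : E} (hv : g x v v = 0) : v = 0 := by
  by_contra h0
  exact (h.g_pos x hx v h0).ne' hv

lemma g_J_right (v w : E) : g x v (J x w) = -g x (J x v) w := by
  have := h.J_orth x hx v (J x w)
  rw [h.J_sq x hx, map_neg] at this
  linarith

/-! ### The gradient -/

lemma exists_equiv : ∃ e : E ≃L[ℝ] (E →L[ℝ] ℝ), (e : E →L[ℝ] E →L[ℝ] ℝ) = g x := by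
  have inj : Function.Injective (g x : E →ₗ[ℝ] E →L[ℝ] ℝ) := by
    rw [← LinearMap.ker_eq_bot, LinearMap.ker_eq_bot']
    intro v hv
    apply h.g_eq_zero hx
    have : g x v = 0 := hv
    simp [this]
  have hr : finrank ℝ E = finrank ℝ (E →L[ℝ] ℝ) := by
    rw [← (LinearMap.toContinuousLinearMap (𝕜 := ℝ) (E := E) (F' := ℝ)).finrank_eq]
    simp
  exact ⟨(LinearEquiv.ofInjectiveOfFinrankEq _ inj hr).toContinuousLinearEquiv, by ext; rfl⟩

lemma g_inverse (f : E →L[ℝ] ℝ) : g x ((g x).inverse f) = f := by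
  obtain ⟨e, he⟩ := h.exists_equiv hx
  rw [← he, ContinuousLinearMap.inverse_equiv]
  simp

lemma inverse_g (v : E) : (g x).inverse (g x v) = v := by
  obtain ⟨e, he⟩ := h.exists_equiv hx
  rw [← he, ContinuousLinearMap.inverse_equiv]
  simp

lemma contDiffAt_inverse : ContDiffAt ℝ ∞ (fun z ↦ (g z).inverse) x := by
  obtain ⟨e, he⟩ := h.exists_equiv hx
  have := contDiffAt_map_inverse (𝕜 := ℝ) (n := ∞) e
  rw [he] at this
  exact this.comp x (h.contDiffAt_g hx)

lemma contDiffAt_gradient : ContDiffAt ℝ ∞ (gradient g μ) x :=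
  (h.contDiffAt_inverse hx).clm_apply (h.contDiffAt_dmu hx)

lemma diff_gradient : DifferentiableAt ℝ (gradient g μ) x :=
  (h.contDiffAt_gradient hx).differentiableAt (by simp)

lemma g_gradient (v : E) : g x (gradient g μ x) v = fderiv ℝ μ x v := by
  rw [gradient, h.g_inverse hx]

lemma gradient_eq_zero_iff : gradient g μ x = 0 ↔ fderiv ℝ μ x = 0 := by
  constructor
  · intro h0
    ext v
    rw [← h.g_gradient hx, h0]
    simp
  · intro h0
    rw [gradient, h0, map_zero]

lemma hess_eq (v w : E) : g x (fderiv ℝ (gradient g μ) x v + Γ x v (gradient g μ x)) w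
    = hess μ Γ x v w := by
  have e : (fun z ↦ g z (gradient g μ z) w) =ᶠ[𝓝 x] fun z ↦ fderiv ℝ μ z w := by
    filter_upwards [h.mem_nhds hx] with z hz using h.g_gradient hz w
  have e2 := congrArg (fun L : E →L[ℝ] ℝ ↦ L v) e.fderiv_eq
  have c (c : E) : DifferentiableAt ℝ (fun _ : E ↦ c) x := differentiableAt_const c
  have dg := h.diff_g hx
  have dK := h.diff_gradient hx
  simp only [fderiv_clm_apply_apply (dg.clm_apply dK) (c w), fderiv_clm_apply_apply dg dK,
    fderiv_clm_apply_apply (h.diff_dmu hx) (c w), fderiv_fun_const,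
    Pi.zero_apply, _root_.zero_apply, map_zero, add_zero,
    _root_.add_apply, h.fderiv_g x hx, h.g_gradient hx] at e2
  simp only [map_add, _root_.add_apply, hess]
  linarith

lemma g_gradient_gradient_pos (h0 : fderiv ℝ μ x ≠ 0) :
    0 < fderiv ℝ μ x (gradient g μ x) := by
  rw [← h.g_gradient hx]
  exact h.g_pos x hx _ fun h1 ↦ h0 ((h.gradient_eq_zero_iff hx).1 h1)

lemma S_eq_zero (hm : μ x = 0) : S x = 0 := by
  ext v
  refine h.g_eq_zero hx ?_
  rw [h.S_symm x hx, h.S_sq x hx, hm]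
  simp

omit h hx in
lemma covS_smul (c : ℝ) (v a : E) : covS S Γ x v (c • a) = c • covS S Γ x v a := by
  simp [covS, smul_add, smul_sub]

lemma g_covS_S_S (u v w : E) : μ x * g x (covS S Γ x u (S x v)) (S x w)
    = μ x * (fderiv ℝ μ x u * g x (S x v) (S x w)) := by
  have h1 := congrArg (fun a ↦ g x a (S x w)) (h.covS_S hx u (S x v))
  simp only [map_add, map_smul, _root_.add_apply, _root_.smul_apply, h.S_sq x hx, covS_smul,
    smul_eq_mul, h.S_symm x hx (covS S Γ x u (S x v))] at h1
  linarith

/-- The differential of `μ` vanishes on the `μ`-eigenspace of `S`: the cyclic identity on a single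
eigenvector `e` reads `3 dμ(e) g(e, e) = 0`. -/
lemma dmu_S (v : E) : fderiv ℝ μ x (S x v) = 0 := by
  by_cases hm : μ x = 0
  · simp [h.S_eq_zero hx hm]
  have h1 := h.g_covS_S_S hx (S x v) v v
  have h2 := h.covS_cyclic hx (S x v) (S x v) (S x v)
  have h3 : g x (covS S Γ x (S x v) (S x v)) (S x v) = 0 := by linarith
  rw [h3] at h1
  have h4 : fderiv ℝ μ x (S x v) * g x (S x v) (S x v) = 0 := by
    simpa [hm] using h1.symm
  rcases mul_eq_zero.1 h4 with h5 | h5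
  · exact h5
  · rw [h.g_eq_zero hx h5, map_zero]

lemma S_gradient : S x (gradient g μ x) = 0 := by
  refine h.g_eq_zero hx ?_
  rw [h.S_symm x hx, h.g_gradient hx, h.dmu_S hx]

/-- Differentiating `dμ ∘ S = 0` expresses `∇S` in the direction of the gradient through the
Hessian of `μ`. -/
lemma dmu_covS (u v : E) : fderiv ℝ μ x (covS S Γ x u v) = - hess μ Γ x u (S x v) := by
  have e : (fun z ↦ fderiv ℝ μ z (S z v)) =ᶠ[𝓝 x] fun _ ↦ 0 := by
    filter_upwards [h.mem_nhds hx] with z hz using h.dmu_S hz v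
  have e2 := congrArg (fun L : E →L[ℝ] ℝ ↦ L u) e.fderiv_eq
  have c (c : E) : DifferentiableAt ℝ (fun _ : E ↦ c) x := differentiableAt_const c
  simp only [fderiv_clm_apply_apply (h.diff_dmu hx) ((h.diff_S hx).clm_apply (c v)),
    fderiv_clm_apply_apply (h.diff_S hx) (c v), fderiv_fun_const,
    Pi.zero_apply, _root_.zero_apply, map_zero, add_zero] at e2
  simp only [covS, hess, map_add, map_sub, h.dmu_S hx]
  linarith

lemma g_covS_gradient (u v : E) :
    g x (covS S Γ x u v) (gradient g μ x) = - hess μ Γ x u (S x v) := by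
  rw [h.g_symm x hx, h.g_gradient hx, h.dmu_covS hx]

omit hx in
lemma hess_add_left (u v w : E) : hess μ Γ x (u + v) w = hess μ Γ x u w + hess μ Γ x v w := by
  simp [hess]; ring

omit hx in
lemma hess_smul_left (c : ℝ) (u w : E) : hess μ Γ x (c • u) w = c * hess μ Γ x u w := by
  simp [hess]; ring

omit hx in
lemma hess_add_right (u v w : E) : hess μ Γ x u (v + w) = hess μ Γ x u v + hess μ Γ x u w := by
  simp [hess]; ring

omit hx in
lemma hess_smul_right (c : ℝ) (u w : E) : hess μ Γ x u (c • w) = c * hess μ Γ x u w := by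
  simp [hess]; ring

/-! ### The zeros of `μ` -/

/-- At a zero of `μ` the second derivative of `S² = μ S` says that every `A = ∇_v S` satisfies
`A² = dμ(v) A`. -/
lemma covS_sq_of_mu_eq_zero (hm : μ x = 0) (v a : E) :
    covS S Γ x v (covS S Γ x v a) = fderiv ℝ μ x v • covS S Γ x v a := by
  have hS := h.S_eq_zero hx hm
  have cov (a : E) : covS S Γ x v a = fderiv ℝ S x v a := by simp [covS, hS]
  have c (c : E) : DifferentiableAt ℝ (fun _ : E ↦ c) x := differentiableAt_const c
  have dS := h.diff_S hx
  have ddS : DifferentiableAt ℝ (fderiv ℝ S) x :=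
    ((h.contDiffAt_S hx).fderiv_right (m := ∞) (by simp)).differentiableAt (by simp)
  -- the first derivative of `S² = μ S` at all points near `x`
  have e : (fun z ↦ (fderiv ℝ S z v) (S z a) + S z (fderiv ℝ S z v a)) =ᶠ[𝓝 x]
      fun z ↦ fderiv ℝ μ z v • S z a + μ z • fderiv ℝ S z v a := by
    filter_upwards [h.mem_nhds hx] with z hz
    have e : (fun z ↦ S z (S z a)) =ᶠ[𝓝 z] fun z ↦ μ z • S z a := by
      filter_upwards [h.mem_nhds hz] with y hy using h.S_sq y hy a
    have e2 := congrArg (fun L : E →L[ℝ] E ↦ L v) e.fderiv_eq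
    have dS := h.diff_S hz
    have c (c : E) : DifferentiableAt ℝ (fun _ : E ↦ c) z := differentiableAt_const c
    simp only [fderiv_clm_apply_apply dS (dS.clm_apply (c a)), fderiv_clm_apply_apply dS (c a),
      fderiv_fun_smul (h.diff_mu hz) (dS.clm_apply (c a)), fderiv_fun_const,
      Pi.zero_apply, _root_.zero_apply, map_zero, add_zero, _root_.add_apply, _root_.smul_apply,
      ContinuousLinearMap.smulRight_apply] at e2
    rw [e2, add_comm]
  have e2 := congrArg (fun L : E →L[ℝ] E ↦ L v) e.fderiv_eq
  have d1 : DifferentiableAt ℝ (fun z ↦ fderiv ℝ S z v) x := ddS.clm_apply (c v)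
  have d2 : DifferentiableAt ℝ (fun z ↦ fderiv ℝ S z v a) x := d1.clm_apply (c a)
  have d3 : DifferentiableAt ℝ (fun z ↦ S z a) x := dS.clm_apply (c a)
  have d4 : DifferentiableAt ℝ (fun z ↦ fderiv ℝ μ z v) x := (h.diff_dmu hx).clm_apply (c v)
  rw [fderiv_fun_add (d1.clm_apply d3) (dS.clm_apply d2),
    fderiv_fun_add (d4.fun_smul d3) ((h.diff_mu hx).fun_smul d2),
    fderiv_fun_smul d4 d3, fderiv_fun_smul (h.diff_mu hx) d2] at e2
  simp only [_root_.add_apply, _root_.smul_apply, ContinuousLinearMap.smulRight_apply,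
    fderiv_clm_apply_apply d1 d3, fderiv_clm_apply_apply dS d2, fderiv_clm_apply_apply dS (c a),
    hS, hm, fderiv_fun_const, Pi.zero_apply, _root_.zero_apply, map_zero, add_zero, zero_add,
    smul_zero, zero_smul] at e2
  rw [← two_smul ℝ, ← two_smul ℝ] at e2
  rw [cov, cov]
  exact smul_right_injective E (two_ne_zero' ℝ) e2

/-- The function `μ` is critical at each of its zeros. -/
lemma dmu_eq_zero_of_mu_eq_zero (hm : μ x = 0) : fderiv ℝ μ x = 0 := by
  by_contra h0
  set K := gradient g μ x with hK
  have hQ := h.g_gradient_gradient_pos hx h0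
  have hS := h.S_eq_zero hx hm
  have cov (v a : E) : covS S Γ x v a = fderiv ℝ S x v a := by simp [covS, hS]
  have sq (v a : E) := h.covS_sq_of_mu_eq_zero hx hm v a
  have symm (v a b : E) := h.covS_symm hx v a b
  simp only [cov] at sq symm
  -- `∇_v S` is symmetric with square zero for `v` in the kernel of `dμ`
  have ker (v : E) (hv : fderiv ℝ μ x v = 0) (a : E) : fderiv ℝ S x v a = 0 := by
    refine h.g_eq_zero hx ?_
    rw [symm, sq, hv]
    simp
  set c := fderiv ℝ μ x K
  have decomp (v a : E) : fderiv ℝ S x v a = (fderiv ℝ μ x v / c) • fderiv ℝ S x K a := by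
    have h1 := ker (v - (fderiv ℝ μ x v / c) • K) (by
      rw [map_sub, map_smul, smul_eq_mul]; change _ - _ * c = 0; field_simp; ring) a
    simpa [sub_eq_zero] using h1
  have cyc (v : E) : g x (fderiv ℝ S x v v) v = 0 := by
    have := h.covS_cyclic hx v v v
    simp only [cov] at this
    linarith
  have zero_of (v : E) (hv : fderiv ℝ μ x v ≠ 0) : fderiv ℝ S x K v = 0 := by
    have h1 := cyc v
    rw [decomp, map_smul, _root_.smul_apply, smul_eq_mul] at h1
    have h2 : g x (fderiv ℝ S x K v) v = 0 := by
      rcases mul_eq_zero.1 h1 with h3 | h3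
      · exact absurd h3 (div_ne_zero hv hQ.ne')
      · exact h3
    refine h.g_eq_zero hx ?_
    rw [symm, sq, map_smul, h.g_symm x hx v, h2, smul_zero]
  have hK0 : fderiv ℝ S x K K = 0 := zero_of K hQ.ne'
  have allz : fderiv ℝ S x K = 0 := by
    ext v
    by_cases hv : fderiv ℝ μ x v = 0
    · have h1 := zero_of (v + K) (by rw [map_add, hv, zero_add]; exact hQ.ne')
      simpa [hK0] using h1
    · simpa using zero_of v hv
  -- taking traces
  have e := (h.eventually_mu_eq hx).fderiv_eq (𝕜 := ℝ)
  set L : (E →L[ℝ] E) →L[ℝ] ℝ := LinearMap.toContinuousLinearMap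
    ((LinearMap.trace ℝ E) ∘ₗ (ContinuousLinearMap.coeLM ℝ : (E →L[ℝ] E) →ₗ[ℝ] _))
  have hL : HasFDerivAt (fun z ↦ L (S z)) (L ∘L fderiv ℝ S x) x :=
    L.hasFDerivAt.comp x (h.diff_S hx).hasFDerivAt
  rw [(hL.const_mul _).fderiv] at e
  have e2 := congrArg (fun L : E →L[ℝ] ℝ ↦ L K) e
  simp only [_root_.smul_apply, ContinuousLinearMap.comp_apply, allz, map_zero, smul_zero] at e2
  exact hQ.ne' e2

/-! ### The Hessian of `μ` and brackets of eigenvector fields at regular points -/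

lemma mu_ne_zero (h0 : fderiv ℝ μ x ≠ 0) : μ x ≠ 0 :=
  fun hm ↦ h0 (h.dmu_eq_zero_of_mu_eq_zero hx hm)

lemma g_J_self (v : E) : g x (J x v) v = 0 := by
  have := h.g_J_right hx v v
  rw [h.g_symm x hx] at this
  linarith

lemma S_J_gradient : S x (J x (gradient g μ x)) = 0 := by
  rw [h.S_comm x hx, h.S_gradient hx, map_zero]

/-- At a regular point every tangent vector is the sum of a `μ`-eigenvector of `S` and a
combination of the gradient `K` and `J K`, which span the kernel of `S`. -/
lemma exists_decomp (h0 : fderiv ℝ μ x ≠ 0) (v : E) : ∃ a b : ℝ,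
    v = S x ((μ x)⁻¹ • v) + (a • gradient g μ x + b • J x (gradient g μ x)) := by
  have hm := h.mu_ne_zero hx h0
  set K := gradient g μ x with hK
  have hQ := h.g_gradient_gradient_pos hx h0
  rw [← hK, ← h.g_gradient hx, ← hK] at hQ
  have hK0 : K ≠ 0 := by
    intro h1; rw [h1] at hQ; simp at hQ
  have hdim := h.finrank_ker x hx hm
  let k : Fin 2 → LinearMap.ker (S x : E →ₗ[ℝ] E) :=
    ![⟨K, h.S_gradient hx⟩, ⟨J x K, h.S_J_gradient hx⟩]
  have hli : LinearIndependent ℝ k := by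
    rw [LinearIndependent.pair_iff]
    intro s t hst
    have h1 : s • K + t • J x K = 0 := congrArg Subtype.val hst
    have h2 := congrArg (fun a ↦ g x a K) h1
    have h3 := congrArg (fun a ↦ g x a (J x K)) h1
    simp only [map_add, map_smul, _root_.add_apply, _root_.smul_apply, smul_eq_mul,
      h.g_J_self hx, h.J_orth x hx, map_zero, _root_.zero_apply, mul_zero, add_zero] at h2 h3
    rw [h.g_symm x hx K, h.g_J_self hx, mul_zero, zero_add] at h3
    exact ⟨(mul_eq_zero.1 h2).resolve_right hQ.ne', (mul_eq_zero.1 h3).resolve_right hQ.ne'⟩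
  have hspan := hli.span_eq_top_of_card_eq_finrank' (by simp [hdim])
  have hmem : v - S x ((μ x)⁻¹ • v) ∈ LinearMap.ker (S x : E →ₗ[ℝ] E) := by
    rw [LinearMap.mem_ker]
    change S x _ = 0
    rw [map_sub, h.S_sq x hx, map_smul, smul_smul, mul_inv_cancel₀ hm, one_smul, sub_self]
  have h4 : (⟨_, hmem⟩ : LinearMap.ker (S x : E →ₗ[ℝ] E)) ∈ Submodule.span ℝ (Set.range k) := by
    rw [hspan]; trivial
  rw [Matrix.range_cons, Matrix.range_cons, Matrix.range_empty, union_empty,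
    Set.singleton_union, Submodule.mem_span_pair] at h4
  obtain ⟨a, b, hab⟩ := h4
  refine ⟨a, b, ?_⟩
  have h5 : a • K + b • J x K = v - S x ((μ x)⁻¹ • v) := congrArg Subtype.val hab
  rw [h5]
  abel

/-- On the `μ`-eigenspace of `S` the Hessian of `μ` is the multiple `|dμ|² / (2μ)` of the metric,
and it pairs this eigenspace to zero with `ker S`: evaluate the cyclic identity on the gradient `K`
and two more vectors, using `dmu_covS`. -/
lemma hess_S (h0 : fderiv ℝ μ x ≠ 0) (v w : E) : hess μ Γ x (S x v) w
    = fderiv ℝ μ x (gradient g μ x) / (2 * μ x) * g x (S x v) w := by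
  have hm := h.mu_ne_zero hx h0
  set K := gradient g μ x with hK
  have tK (u v : E) := h.g_covS_gradient hx u v
  have tS (u v w : E) : g x (covS S Γ x u v) w = g x (covS S Γ x u w) v := by
    rw [h.covS_symm hx, h.g_symm x hx]
  rw [← hK] at tK
  have SK : S x K = 0 := h.S_gradient hx
  have SJK : S x (J x K) = 0 := h.S_J_gradient hx
  have hz (u : E) : hess μ Γ x u 0 = 0 := by simp [hess]
  -- `Hess(K, S w)`, `Hess(J K, S w)` and `Hess(S v, S w)` come from the cyclic identity on
  -- `(K, K, w)`, `(J K, K, w)` and `(S v, K, S w)`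
  have t1 (w : E) : g x (covS S Γ x K w) K = 0 := by
    have h1 := h.covS_cyclic hx K K w
    have h2 := tS K K w
    have h3 := tK w K
    rw [SK, hz] at h3
    linarith
  have k1 (w : E) : hess μ Γ x K (S x w) = 0 := by linarith [t1 w, tK K w]
  have k2 (w : E) : hess μ Γ x (J x K) (S x w) = 0 := by
    have h1 := h.covS_cyclic hx (J x K) K w
    have h2 := tS (J x K) K w
    have h3 := tK w (J x K)
    rw [SJK, hz] at h3
    have h4 : g x (covS S Γ x K w) (J x K) = 0 := by
      rw [h.g_J_right hx, ← h.covS_J hx, t1, neg_zero]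
    linarith [tK (J x K) w]
  have k3 (w : E) : hess μ Γ x (S x v) (S x w)
      = fderiv ℝ μ x K / (2 * μ x) * g x (S x v) (S x w) := by
    have h1 := h.covS_cyclic hx (S x v) K (S x w)
    have h2 := tS (S x v) K (S x w)
    have h3 := tK (S x v) (S x w)
    have h4 := tK (S x w) (S x v)
    rw [h.S_sq x hx, h.hess_smul_right] at h3 h4
    have h5 : g x (covS S Γ x K (S x w)) (S x v) = fderiv ℝ μ x K * g x (S x w) (S x v) :=
      mul_left_cancel₀ hm (h.g_covS_S_S hx K w v)
    rw [h.g_symm x hx (S x w)] at h5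
    rw [h.hess_symm hx (S x w)] at h4
    field_simp
    linarith
  obtain ⟨a, b, hab⟩ := h.exists_decomp hx h0 w
  rw [hab, h.hess_add_right, h.hess_add_right, h.hess_smul_right, h.hess_smul_right, k3,
    h.hess_symm hx _ (gradient g μ x), h.hess_symm hx _ (J x _), k1, k2]
  simp only [map_add, map_smul, smul_eq_mul]
  rw [h.S_symm x hx v (gradient g μ x), SK, h.S_symm x hx v (J x _), SJK]
  simp

/-- Modulo the `μ`-eigenspace of `S`, the bracket of the `μ`-eigenvector fields `S v` and `S w`, for
constant `v` and `w`, is `-ω(S v, S w) / μ` times `J K`, where `ω = g(J·, ·)`. -/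
lemma exists_bracket (h0 : fderiv ℝ μ x ≠ 0) (v w : E) : ∃ r,
    fderiv ℝ S x (S x v) w - fderiv ℝ S x (S x w) v
      = ((μ x)⁻¹ * g x (S x v) (J x (S x w))) • J x (gradient g μ x) + S x r := by
  have hm := h.mu_ne_zero hx h0
  set K := gradient g μ x with hK
  have hQ := h.g_gradient_gradient_pos hx h0
  have tK (u v : E) := h.g_covS_gradient hx u v
  rw [← hK] at tK hQ
  set z := covS S Γ x (S x v) w - covS S Γ x (S x w) v with hz
  obtain ⟨a, b, hab⟩ := h.exists_decomp hx h0 z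
  rw [← hK] at hab
  have gK : g x z K = 0 := by
    rw [hz, map_sub, _root_.sub_apply, tK, tK, h.hess_symm hx (S x w), sub_self]
  have gJK : g x z (J x K)
      = fderiv ℝ μ x K / μ x * g x (S x v) (J x (S x w)) := by
    have h1 : g x (J x (S x v)) (S x w) = -g x (S x v) (J x (S x w)) := by
      rw [h.g_J_right hx, neg_neg]
    rw [hz, h.g_J_right hx, map_sub, ← h.covS_J hx, ← h.covS_J hx, map_sub, _root_.sub_apply,
      tK, tK, h.hess_S hx h0, h.hess_S hx h0, h.S_comm x hx, h.S_comm x hx,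
      h.g_symm x hx (S x w), h1]
    field_simp
    ring
  have SK : S x K = 0 := h.S_gradient hx
  have SJK : S x (J x K) = 0 := h.S_J_gradient hx
  have KK : g x K K = fderiv ℝ μ x K := h.g_gradient hx K
  have a0 : a = 0 := by
    have h1 := congrArg (fun y ↦ g x y K) hab
    simp only [map_add, map_smul, _root_.add_apply, _root_.smul_apply, smul_eq_mul,
      h.g_J_self hx, gK, h.S_symm x hx, SK, KK] at h1
    simpa [SK, hQ.ne'] using h1
  have b0 : b = (μ x)⁻¹ * g x (S x v) (J x (S x w)) := by
    have h1 := congrArg (fun y ↦ g x y (J x K)) hab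
    simp only [map_add, map_smul, _root_.add_apply, _root_.smul_apply, smul_eq_mul,
      gJK, h.S_symm x hx _ (J x K), SJK, h.J_orth x hx, KK, map_zero] at h1
    rw [a0] at h1
    have h2 : fderiv ℝ μ x K * (b - (μ x)⁻¹ * g x (S x v) (J x (S x w))) = 0 := by
      rw [mul_sub]
      rw [div_mul_eq_mul_div, div_eq_iff hm] at h1
      field_simp
      linarith
    linarith [(mul_eq_zero.1 h2).resolve_left hQ.ne']
  refine ⟨(μ x)⁻¹ • z + Γ x (S x v) w - Γ x (S x w) v, ?_⟩
  have h2 : fderiv ℝ S x (S x v) w - fderiv ℝ S x (S x w) v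
      = z + S x (Γ x (S x v) w) - S x (Γ x (S x w) v) := by
    simp only [hz, covS]
    rw [h.Γ_symm x hx (S x w) (S x v)]
    abel
  rw [h2, ← b0, map_sub, map_add]
  nth_rewrite 1 [hab]
  rw [a0]
  simp only [zero_smul, zero_add]
  abel

lemma eventually_regular (h0 : fderiv ℝ μ x ≠ 0) : ∀ᶠ z in 𝓝 x, z ∈ Ω ∧ fderiv ℝ μ z ≠ 0 :=
  (h.mem_nhds hx).and ((h.contDiffAt_dmu hx).continuousAt.eventually_ne h0)

lemma exists_S_ne_zero (h0 : fderiv ℝ μ x ≠ 0) : ∃ v, S x v ≠ 0 := by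
  by_contra! hS
  have h1 : S x = 0 := by ext v; simp [hS]
  have h2 := h.trace_S x hx
  have h3 : (2 : ℝ) < finrank ℝ E := by exact_mod_cast h.two_lt
  rw [h1] at h2
  simp only [ContinuousLinearMap.toLinearMap_zero, map_zero] at h2
  rcases mul_eq_zero.1 h2.symm with h4 | h4
  · linarith
  · exact h.mu_ne_zero hx h0 h4

/-- A function which is constant along the `μ`-eigenspaces of `S` is constant along `J K`, since
brackets of `μ`-eigenvector fields have a component along `J K`. -/
lemma fderiv_J_gradient_eq_zero (h0 : fderiv ℝ μ x ≠ 0) {f : E → ℝ} (hf : ContDiffAt ℝ 2 f x)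
    (hfS : ∀ᶠ z in 𝓝 x, ∀ v, fderiv ℝ f z (S z v) = 0) :
    fderiv ℝ f x (J x (gradient g μ x)) = 0 := by
  have hm := h.mu_ne_zero hx h0
  have df : DifferentiableAt ℝ (fderiv ℝ f) x :=
    (hf.fderiv_right (m := 1) (by norm_num)).differentiableAt (by simp)
  have c (c : E) : DifferentiableAt ℝ (fun _ : E ↦ c) x := differentiableAt_const c
  have key (u v : E) : fderiv ℝ (fderiv ℝ f) x u (S x v) + fderiv ℝ f x (fderiv ℝ S x u v) = 0 := by
    have e : (fun z ↦ fderiv ℝ f z (S z v)) =ᶠ[𝓝 x] fun _ ↦ 0 := by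
      filter_upwards [hfS] with z hz using hz v
    have e2 := congrArg (fun L : E →L[ℝ] ℝ ↦ L u) e.fderiv_eq
    simpa only [fderiv_clm_apply_apply df ((h.diff_S hx).clm_apply (c v)),
      fderiv_clm_apply_apply (h.diff_S hx) (c v), fderiv_fun_const,
      Pi.zero_apply, _root_.zero_apply, map_zero, add_zero] using e2
  -- the bracket of the eigenvector fields `S (J w)` and `S w` has a nonzero component along `J K`
  obtain ⟨w, hw⟩ := h.exists_S_ne_zero hx h0
  obtain ⟨r, hr⟩ := h.exists_bracket hx h0 (J x w) w
  have h1 := congrArg (fderiv ℝ f x) hr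
  have hsym := (hf.isSymmSndFDerivAt (by rw [minSmoothness_of_isRCLikeNormedField])).eq
    (S x (J x w)) (S x w)
  have h2 := key (S x (J x w)) w
  have h3 := key (S x w) (J x w)
  rw [map_sub, map_add, hfS.self_of_nhds, add_zero, map_smul, smul_eq_mul, h.S_comm x hx,
    h.J_orth x hx] at h1
  rw [h.S_comm x hx] at h2 h3 hsym
  have h4 : (μ x)⁻¹ * g x (S x w) (S x w) * fderiv ℝ f x (J x (gradient g μ x)) = 0 := by
    linarith
  exact (mul_eq_zero.1 h4).resolve_left
    (mul_ne_zero (inv_ne_zero hm) (h.g_pos x hx _ hw).ne')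

lemma contDiffAt_sqNorm : ContDiffAt ℝ ∞ (fun z ↦ fderiv ℝ μ z (gradient g μ z)) x :=
  (h.contDiffAt_dmu hx).clm_apply (h.contDiffAt_gradient hx)

lemma fderiv_sqNorm (v : E) : fderiv ℝ (fun z ↦ fderiv ℝ μ z (gradient g μ z)) x v
    = 2 * hess μ Γ x v (gradient g μ x) := by
  rw [fderiv_clm_apply_apply (h.diff_dmu hx) (h.diff_gradient hx)]
  have h1 := h.hess_eq hx v (gradient g μ x)
  rw [h.g_symm x hx, h.g_gradient hx, map_add] at h1
  have h2 : hess μ Γ x v (gradient g μ x) = fderiv ℝ (fderiv ℝ μ) x v (gradient g μ x)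
    - fderiv ℝ μ x (Γ x v (gradient g μ x)) := rfl
  linarith

lemma hess_S_gradient (h0 : fderiv ℝ μ x ≠ 0) (v : E) :
    hess μ Γ x (S x v) (gradient g μ x) = 0 := by
  rw [h.hess_S hx h0, h.S_symm x hx, h.S_gradient hx, map_zero, mul_zero]

lemma hess_J_gradient_gradient (h0 : fderiv ℝ μ x ≠ 0) :
    hess μ Γ x (J x (gradient g μ x)) (gradient g μ x) = 0 := by
  have h1 := h.fderiv_J_gradient_eq_zero hx h0
    ((h.contDiffAt_sqNorm hx).of_le (WithTop.coe_le_coe.2 (le_top : (2 : ℕ∞) ≤ ⊤))) (by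
      filter_upwards [h.eventually_regular hx h0] with z hz v
      rw [h.fderiv_sqNorm hz.1, h.hess_S_gradient hz.1 hz.2, mul_zero])
  rw [h.fderiv_sqNorm hx] at h1
  linarith

/-! ### The 2-form `d(-dμ ∘ J)` -/

lemma contDiffAt_conjDiff : ContDiffAt ℝ ∞ (conjDiff J μ) x :=
  ((h.contDiffAt_dmu hx).clm_comp (h.contDiffAt_J hx)).neg

lemma contDiffAt_fderiv_conjDiff : ContDiffAt ℝ ∞ (fderiv ℝ (conjDiff J μ)) x :=
  (h.contDiffAt_conjDiff hx).fderiv_right (by simp)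

lemma fderiv_conjDiff (v w : E) : fderiv ℝ (conjDiff J μ) x v w
    = - hess μ Γ x v (J x w) - fderiv ℝ μ x (J x (Γ x v w)) := by
  have c (c : E) : DifferentiableAt ℝ (fun _ : E ↦ c) x := differentiableAt_const c
  have e : (fun z ↦ conjDiff J μ z w) = fun z ↦ -(fderiv ℝ μ z (J z w)) := by
    ext z; simp [conjDiff]
  have e2 := congrArg (fun f ↦ fderiv ℝ f x v) e
  simp only [fderiv_clm_apply_apply ((h.contDiffAt_conjDiff hx).differentiableAt (by simp)) (c w),
    fderiv_fun_neg, _root_.neg_apply,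
    fderiv_clm_apply_apply (h.diff_dmu hx) ((h.diff_J hx).clm_apply (c w)),
    fderiv_clm_apply_apply (h.diff_J hx) (c w), fderiv_fun_const,
    Pi.zero_apply, _root_.zero_apply, map_zero, add_zero, h.fderiv_J x hx, map_sub] at e2
  rw [e2, hess]
  ring

lemma defectForm_apply (v w : E) : defectForm g J μ x v w
    = hess μ Γ x w (J x v) - hess μ Γ x v (J x w)
      - fderiv ℝ μ x (gradient g μ x) / μ x * g x (J x v) w := by
  simp only [defectForm, _root_.sub_apply, _root_.smul_apply, ContinuousLinearMap.flip_apply,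
    ContinuousLinearMap.comp_apply, h.fderiv_conjDiff hx, smul_eq_mul]
  rw [h.Γ_symm x hx w v]
  ring

lemma defectForm_swap (v w : E) : defectForm g J μ x v w = - defectForm g J μ x w v := by
  rw [h.defectForm_apply hx, h.defectForm_apply hx, h.g_symm x hx (J x v), h.g_J_right hx]
  ring

lemma defectForm_S (h0 : fderiv ℝ μ x ≠ 0) (v w : E) : defectForm g J μ x (S x v) w = 0 := by
  rw [h.defectForm_apply hx, ← h.S_comm x hx, h.hess_symm hx w, h.hess_S hx h0, h.hess_S hx h0,
    h.S_comm x hx, h.g_J_right hx]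
  ring

lemma contDiffAt_ratio (h0 : fderiv ℝ μ x ≠ 0) :
    ContDiffAt ℝ ∞ (fun z ↦ fderiv ℝ μ z (gradient g μ z) / μ z) x :=
  (h.contDiffAt_sqNorm hx).div (h.contDiffAt_mu hx) (h.mu_ne_zero hx h0)

lemma fderiv_ratio (h0 : fderiv ℝ μ x ≠ 0) (v : E) :
    μ x ^ 2 * fderiv ℝ (fun z ↦ fderiv ℝ μ z (gradient g μ z) / μ z) x v
    = 2 * hess μ Γ x v (gradient g μ x) * μ x
      - fderiv ℝ μ x (gradient g μ x) * fderiv ℝ μ x v := by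
  have hm := h.mu_ne_zero hx h0
  have e : (fun z ↦ fderiv ℝ μ z (gradient g μ z) / μ z * μ z) =ᶠ[𝓝 x]
      fun z ↦ fderiv ℝ μ z (gradient g μ z) := by
    filter_upwards [h.eventually_regular hx h0] with z hz
    rw [div_mul_cancel₀ _ (h.mu_ne_zero hz.1 hz.2)]
  have e2 := congrArg (fun L : E →L[ℝ] ℝ ↦ L v) e.fderiv_eq
  rw [fderiv_fun_mul ((h.contDiffAt_ratio hx h0).differentiableAt (by simp)) (h.diff_mu hx)] at e2
  simp only [_root_.add_apply, _root_.smul_apply, smul_eq_mul, h.fderiv_sqNorm hx] at e2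
  have e3 := congrArg (fun t ↦ μ x * t) e2
  have e4 : μ x * (fderiv ℝ μ x (gradient g μ x) / μ x * fderiv ℝ μ x v)
      = fderiv ℝ μ x (gradient g μ x) * fderiv ℝ μ x v := by field_simp
  rw [mul_add, e4] at e3
  linarith

lemma diff_kahlerForm : DifferentiableAt ℝ (fun z ↦ g z ∘L J z) x :=
  DifferentiableAt.clm_comp (h.diff_g hx) (h.diff_J hx)

lemma diff_defectForm (h0 : fderiv ℝ μ x ≠ 0) : DifferentiableAt ℝ (defectForm g J μ) x := by
  have dA : DifferentiableAt ℝ (fderiv ℝ (conjDiff J μ)) x :=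
    (h.contDiffAt_fderiv_conjDiff hx).differentiableAt (by simp)
  have du : DifferentiableAt ℝ (fun z ↦ fderiv ℝ μ z (gradient g μ z) / μ z) x :=
    (h.contDiffAt_ratio hx h0).differentiableAt (by simp)
  have dflip : DifferentiableAt ℝ (fun z ↦ (fderiv ℝ (conjDiff J μ) z).flip) x :=
    differentiableAt_flip dA
  have dsmul := differentiableAt_smul (F := E →L[ℝ] E →L[ℝ] ℝ) du (h.diff_kahlerForm hx)
  have dsub := DifferentiableAt.sub (𝕜 := ℝ) (E := E) (F := E →L[ℝ] E →L[ℝ] ℝ) dA dflip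
  exact DifferentiableAt.sub (𝕜 := ℝ) (E := E) (F := E →L[ℝ] E →L[ℝ] ℝ) dsub dsmul

/-- The exterior derivative of `defectForm` is `-d(|dμ|²/μ) ∧ ω`, because `ω` is closed. -/
lemma fderiv_defectForm_cyclic (h0 : fderiv ℝ μ x ≠ 0) (a b c : E) :
    fderiv ℝ (defectForm g J μ) x a b c + fderiv ℝ (defectForm g J μ) x b c a
      + fderiv ℝ (defectForm g J μ) x c a b
    = - (fderiv ℝ (fun z ↦ fderiv ℝ μ z (gradient g μ z) / μ z) x a * g x (J x b) c
      + fderiv ℝ (fun z ↦ fderiv ℝ μ z (gradient g μ z) / μ z) x b * g x (J x c) a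
      + fderiv ℝ (fun z ↦ fderiv ℝ μ z (gradient g μ z) / μ z) x c * g x (J x a) b) := by
  set u := fun z ↦ fderiv ℝ μ z (gradient g μ z) / μ z with hu
  have k (c : E) : DifferentiableAt ℝ (fun _ : E ↦ c) x := differentiableAt_const c
  have dA : DifferentiableAt ℝ (fderiv ℝ (conjDiff J μ)) x :=
    (h.contDiffAt_fderiv_conjDiff hx).differentiableAt (by simp)
  have du : DifferentiableAt ℝ u x := (h.contDiffAt_ratio hx h0).differentiableAt (by simp)
  have dθ := h.diff_defectForm hx h0
  have main (a b c : E) : fderiv ℝ (defectForm g J μ) x a b c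
      = fderiv ℝ (fderiv ℝ (conjDiff J μ)) x a b c - fderiv ℝ (fderiv ℝ (conjDiff J μ)) x a c b
        - (fderiv ℝ u x a * g x (J x b) c
          + u x * (g x (J x (Γ x a b)) c + g x (J x b) (Γ x a c))) := by
    have e : (fun z ↦ defectForm g J μ z b c) = fun z ↦ fderiv ℝ (conjDiff J μ) z b c
        - fderiv ℝ (conjDiff J μ) z c b - u z * g z (J z b) c := by
      ext z; rfl
    have e2 := congrArg (fun f ↦ fderiv ℝ f x a) e
    have d1 := (dA.clm_apply (k b)).clm_apply (k c)
    have d2 := (dA.clm_apply (k c)).clm_apply (k b)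
    have d3 := ((h.diff_g hx).clm_apply ((h.diff_J hx).clm_apply (k b))).clm_apply (k c)
    rw [fderiv_fun_sub (d1.fun_sub d2) (du.fun_mul d3), fderiv_fun_sub d1 d2,
      fderiv_fun_mul du d3] at e2
    simp only [fderiv_clm_apply_apply (dθ.clm_apply (k b)) (k c), fderiv_clm_apply_apply dθ (k b),
      _root_.add_apply, _root_.sub_apply, _root_.smul_apply, smul_eq_mul,
      fderiv_clm_apply_apply (dA.clm_apply (k b)) (k c), fderiv_clm_apply_apply dA (k b),
      fderiv_clm_apply_apply (dA.clm_apply (k c)) (k b), fderiv_clm_apply_apply dA (k c),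
      fderiv_clm_apply_apply ((h.diff_g hx).clm_apply ((h.diff_J hx).clm_apply (k b))) (k c),
      fderiv_clm_apply_apply (h.diff_g hx) ((h.diff_J hx).clm_apply (k b)),
      fderiv_clm_apply_apply (h.diff_J hx) (k b), fderiv_fun_const,
      Pi.zero_apply, _root_.zero_apply, map_zero, add_zero, h.fderiv_J x hx, h.fderiv_g x hx,
      map_sub] at e2
    rw [e2]
    ring
  have sym (a b c : E) : fderiv ℝ (fderiv ℝ (conjDiff J μ)) x a b c
      = fderiv ℝ (fderiv ℝ (conjDiff J μ)) x b a c := by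
    rw [((h.contDiffAt_conjDiff hx).isSymmSndFDerivAt
      (by rw [minSmoothness_of_isRCLikeNormedField];
          exact WithTop.coe_le_coe.2 (le_top : (2 : ℕ∞) ≤ ⊤))).eq a b]
  have om (v w : E) : g x (J x v) w = - g x (J x w) v := by
    rw [h.g_symm x hx (J x v), h.g_J_right hx]
  rw [main, main, main, sym b c a, sym a c b, sym b a c, h.Γ_symm x hx b a, h.Γ_symm x hx c a,
    h.Γ_symm x hx c b, om (Γ x a b) c, om (Γ x b c) a, om (Γ x a c) b]
  ring

/-- The gradient direction and its rotation by `J` carry the same second derivative of `μ`: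
evaluate `d(defectForm)` on `K` and two `μ`-eigenvectors of `S`. -/
lemma hess_J_gradient_J_gradient (h0 : fderiv ℝ μ x ≠ 0) :
    hess μ Γ x (J x (gradient g μ x)) (J x (gradient g μ x))
      = hess μ Γ x (gradient g μ x) (gradient g μ x) := by
  have hm := h.mu_ne_zero hx h0
  set K := gradient g μ x with hK
  have hQ := h.g_gradient_gradient_pos hx h0
  rw [← hK] at hQ
  have k (c : E) : DifferentiableAt ℝ (fun _ : E ↦ c) x := differentiableAt_const c
  have dθ := h.diff_defectForm hx h0
  -- differentiating `defectForm (S v) w = 0`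
  have d1 (a v w : E) : fderiv ℝ (defectForm g J μ) x a (S x v) w
      = - defectForm g J μ x (fderiv ℝ S x a v) w := by
    have e : (fun z ↦ defectForm g J μ z (S z v) w) =ᶠ[𝓝 x] fun _ ↦ 0 := by
      filter_upwards [h.eventually_regular hx h0] with z hz using h.defectForm_S hz.1 hz.2 v w
    have e2 := congrArg (fun L : E →L[ℝ] ℝ ↦ L a) e.fderiv_eq
    have dS := (h.diff_S hx).clm_apply (k v)
    simp only [fderiv_clm_apply_apply (dθ.clm_apply dS) (k w), fderiv_clm_apply_apply dθ dS,
      fderiv_clm_apply_apply (h.diff_S hx) (k v), fderiv_fun_const, _root_.add_apply,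
      Pi.zero_apply, _root_.zero_apply, map_zero, add_zero] at e2
    linarith
  have d2 (a v w : E) : fderiv ℝ (defectForm g J μ) x a v w
      = - fderiv ℝ (defectForm g J μ) x a w v := by
    have e : (fun z ↦ defectForm g J μ z v w) =ᶠ[𝓝 x] fun z ↦ -(defectForm g J μ z w v) := by
      filter_upwards [h.mem_nhds hx] with z hz using h.defectForm_swap hz v w
    have e2 := congrArg (fun L : E →L[ℝ] ℝ ↦ L a) e.fderiv_eq
    simpa only [fderiv_fun_neg, _root_.neg_apply, fderiv_clm_apply_apply (dθ.clm_apply (k v)) (k w),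
      fderiv_clm_apply_apply (dθ.clm_apply (k w)) (k v), fderiv_clm_apply_apply dθ (k _),
      fderiv_fun_const, Pi.zero_apply, _root_.zero_apply, map_zero, add_zero] using e2
  have ratioS (v : E) : fderiv ℝ (fun z ↦ fderiv ℝ μ z (gradient g μ z) / μ z) x (S x v) = 0 := by
    have h1 := h.fderiv_ratio hx h0 (S x v)
    rw [h.hess_S_gradient hx h0, h.dmu_S hx, mul_zero, zero_mul, mul_zero, sub_zero] at h1
    exact (mul_eq_zero.1 h1).resolve_left (pow_ne_zero 2 hm)
  obtain ⟨w, hw⟩ := h.exists_S_ne_zero hx h0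
  have hG := h.g_pos x hx _ hw
  have cyc := h.fderiv_defectForm_cyclic hx h0 K (S x (J x w)) (S x w)
  rw [ratioS, ratioS, d1, d1, d2 (S x w), d1, h.defectForm_swap hx _ (S x w),
    h.defectForm_S hx h0] at cyc
  obtain ⟨r, hr⟩ := h.exists_bracket hx h0 (J x w) w
  have h1 := congrArg (fun y ↦ defectForm g J μ x y K) hr
  rw [← hK] at h1
  simp only [map_sub, map_add, map_smul, _root_.add_apply, _root_.sub_apply, _root_.smul_apply,
    h.defectForm_S hx h0, smul_eq_mul, add_zero] at h1
  have gneg (a b : E) : g x (-a) b = -g x a b := by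
    rw [h.g_symm x hx, map_neg, h.g_symm x hx]
  have hd := h.defectForm_apply hx (J x K) K
  rw [h.J_sq x hx, gneg, h.g_gradient hx] at hd
  rw [← hK] at hd
  rw [hd] at h1
  rw [h.S_comm x hx, h.J_sq x hx, gneg] at cyc
  have hneg : hess μ Γ x K (-K) = - hess μ Γ x K K := by
    have := h.hess_smul_right (x := x) (-1) K K
    simpa using this
  rw [hneg] at h1
  have ratioK := h.fderiv_ratio hx h0 K
  rw [← hK] at ratioK
  rw [h.S_comm x hx, h.J_orth x hx] at h1
  set u' := fderiv ℝ (fun z ↦ fderiv ℝ μ z (gradient g μ z) / μ z) x K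
  set G := g x (S x w) (S x w)
  set Q := fderiv ℝ μ x K
  set P := hess μ Γ x K K
  set R := hess μ Γ x (J x K) (J x K)
  have h2 : (μ x)⁻¹ * G * (-P - R - Q / μ x * -Q) = - (u' * G) := by
    linarith
  have h3 : G * (P - R) = 0 := by
    have h4 := congrArg (fun t ↦ μ x ^ 2 * t) h2
    have h5 : μ x ^ 2 * ((μ x)⁻¹ * G * (-P - R - Q / μ x * -Q))
        = G * (μ x * (-P - R) + Q * Q) := by field_simp; ring
    simp only [h5] at h4
    have h6 : μ x * (G * (P - R)) = 0 := by
      linear_combination h4 - G * ratioK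
    exact (mul_eq_zero.1 h6).resolve_left hm
  linarith [(mul_eq_zero.1 h3).resolve_left hG.ne']

/-- The Hessian of `μ` is `J`-invariant at regular points. -/
lemma hess_J_J (h0 : fderiv ℝ μ x ≠ 0) (v w : E) :
    hess μ Γ x (J x v) (J x w) = hess μ Γ x v w := by
  set K := gradient g μ x with hK
  have hS (v w : E) : hess μ Γ x (J x (S x v)) (J x w) = hess μ Γ x (S x v) w := by
    rw [← h.S_comm x hx, h.hess_S hx h0, h.hess_S hx h0, h.S_comm x hx, h.J_orth x hx]
  have hS' (v w : E) : hess μ Γ x (J x w) (J x (S x v)) = hess μ Γ x w (S x v) := by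
    rw [h.hess_symm hx, hS, h.hess_symm hx]
  have hJK := h.hess_J_gradient_gradient hx h0
  have hJJ := h.hess_J_gradient_J_gradient hx h0
  rw [← hK] at hJK hJJ
  have hKJ : hess μ Γ x K (J x K) = 0 := by rw [h.hess_symm hx, hJK]
  have neg_right (a b : E) : hess μ Γ x a (-b) = - hess μ Γ x a b := by
    simpa using h.hess_smul_right (x := x) (-1) a b
  have neg_left (a b : E) : hess μ Γ x (-a) b = - hess μ Γ x a b := by
    simpa using h.hess_smul_left (x := x) (-1) a b
  obtain ⟨a, b, hv⟩ := h.exists_decomp hx h0 v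
  obtain ⟨c, d, hw⟩ := h.exists_decomp hx h0 w
  rw [← hK] at hv hw
  rw [hv, hw]
  generalize (μ x)⁻¹ • v = v'
  generalize (μ x)⁻¹ • w = w'
  simp only [map_add, map_smul, h.hess_add_left, h.hess_add_right, h.hess_smul_left,
    h.hess_smul_right, hS, hS', h.J_sq x hx, neg_left, neg_right, hJK, hJJ, hKJ]
  have z1 : hess μ Γ x (J x (S x v')) (-K) = hess μ Γ x (S x v') (J x K) := by
    rw [← h.J_sq x hx, hS]
  have z2 : hess μ Γ x (-K) (J x (S x w')) = hess μ Γ x (J x K) (S x w') := by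
    rw [← h.J_sq x hx, hS']
  rw [neg_right] at z1
  rw [neg_left] at z2
  linear_combination d * z1 + b * z2

/-- The rotated gradient `J K` is a Killing field near regular points. -/
lemma lieDerivMetric_J_gradient (h0 : fderiv ℝ μ x ≠ 0) (v w : E) :
    lieDerivMetric g (fun z ↦ J z (gradient g μ z)) x v w = 0 := by
  set K := gradient g μ x with hK
  have dξ (v : E) : fderiv ℝ (fun z ↦ J z (gradient g μ z)) x v
      = J x (fderiv ℝ (gradient g μ) x v + Γ x v K) - Γ x v (J x K) := by
    rw [fderiv_clm_apply_apply (h.diff_J hx) (h.diff_gradient hx), h.fderiv_J x hx, map_add]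
    abel
  have hv := h.hess_eq hx v (J x w)
  have hw := h.hess_eq hx w (J x v)
  rw [h.g_J_right hx] at hv hw
  have hsum : hess μ Γ x v (J x w) + hess μ Γ x w (J x v) = 0 := by
    have h1 := h.hess_J_J hx h0 v (J x w)
    have h2 : hess μ Γ x (J x v) (-w) = - hess μ Γ x (J x v) w := by
      simpa using h.hess_smul_right (x := x) (-1) (J x v) w
    rw [h.J_sq x hx, h2, h.hess_symm hx (J x v)] at h1
    linarith
  rw [lieDerivMetric, dξ, dξ, h.fderiv_g x hx, ← hK, map_sub, map_sub, _root_.sub_apply,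
    h.Γ_symm x hx (J x K) v, h.Γ_symm x hx (J x K) w,
    h.g_symm x hx v (J x (fderiv ℝ (gradient g μ) x w + Γ x w K))]
  linarith

end KillingChart

end LocalCalculus

/-! ### Unique continuation for Killing fields -/

section UniqueContinuation

open Filter Topology Module

variable {E : Type*} [NormedAddCommGroup E] [NormedSpace ℝ E]

lemma continuousAt_norm_fderiv {G : Type*} [NormedAddCommGroup G] [NormedSpace ℝ G] {F : E → G}
    {x : E} (hF : ContDiffAt ℝ ∞ F x) : ContinuousAt (fun z ↦ ‖fderiv ℝ F z‖) x ∧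
      ContinuousAt (fun z ↦ ‖fderiv ℝ (fderiv ℝ F) z‖) x := by
  have d1 : ContDiffAt ℝ ∞ (fderiv ℝ F) x := hF.fderiv_right (by simp)
  have d2 : ContDiffAt ℝ ∞ (fderiv ℝ (fderiv ℝ F)) x := d1.fderiv_right (by simp)
  exact ⟨d1.continuousAt.norm, d2.continuousAt.norm⟩

/-- Grönwall's inequality along a segment, for a map whose derivative is bounded by its values. -/
lemma eq_zero_of_norm_fderiv_le {G : Type*} [NormedAddCommGroup G] [NormedSpace ℝ G] {F : E → G}
    {a b : E} {C : ℝ} (hd : ∀ x ∈ segment ℝ a b, DifferentiableAt ℝ F x)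
    (hC : ∀ x ∈ segment ℝ a b, ‖fderiv ℝ F x‖ ≤ C * ‖F x‖) (ha : F a = 0) : F b = 0 := by
  have hγ (t : ℝ) (ht : t ∈ Icc (0 : ℝ) 1) : AffineMap.lineMap a b t ∈ segment ℝ a b := by
    rw [segment_eq_image_lineMap]; exact mem_image_of_mem _ ht
  have hder (t : ℝ) (ht : t ∈ Icc (0 : ℝ) 1) : HasDerivAt (fun t : ℝ ↦ F (AffineMap.lineMap a b t))
      (fderiv ℝ F (AffineMap.lineMap a b t) (b - a)) t :=
    (hd _ (hγ t ht)).hasFDerivAt.comp_hasDerivAt t AffineMap.hasDerivAt_lineMap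
  have h1 := norm_le_gronwallBound_of_norm_deriv_right_le (δ := 0) (K := C * ‖b - a‖) (ε := 0)
    (a := 0) (b := 1) (f := fun t : ℝ ↦ F (AffineMap.lineMap a b t))
    (f' := fun t ↦ fderiv ℝ F (AffineMap.lineMap a b t) (b - a))
    (fun t ht ↦ (hder t ht).continuousAt.continuousWithinAt)
    (fun t ht ↦ (hder t (Ico_subset_Icc_self ht)).hasDerivWithinAt) (by simp [ha])
    (fun t ht ↦ by
      have h2 := hC _ (hγ t (Ico_subset_Icc_self ht))
      calc _ ≤ ‖fderiv ℝ F (AffineMap.lineMap a b t)‖ * ‖b - a‖ :=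
            ContinuousLinearMap.le_opNorm _ _
        _ ≤ C * ‖F (AffineMap.lineMap a b t)‖ * ‖b - a‖ := by gcongr
        _ = _ := by ring) 1 (by simp)
  simpa [gronwallBound_ε0] using h1

/-- A segment that starts in an open set `G` and ends outside `G` has a first point outside `G`. -/
lemma exists_first_exit {G : Set E} (hG : IsOpen G) {x y : E} (hx : x ∈ G) (hy : y ∉ G) :
    ∃ z ∈ segment ℝ x y, z ∉ G ∧ z ∈ closure G ∧ segment ℝ x z ⊆ closure G := by
  let γ : ℝ → E := AffineMap.lineMap x y
  have hγ : Continuous γ := AffineMap.lineMap_continuous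
  let T : Set ℝ := Icc 0 1 ∩ γ ⁻¹' Gᶜ
  have hT : IsClosed T := isClosed_Icc.inter (hG.isClosed_compl.preimage hγ)
  have hTne : T.Nonempty := ⟨1, by simp, by simpa [γ] using hy⟩
  have hTb : BddBelow T := ⟨0, fun t ht ↦ ht.1.1⟩
  set s := sInf T with hs
  have hsT : s ∈ T := hT.csInf_mem hTne hTb
  have hs0 : 0 < s := by
    refine lt_of_le_of_ne hsT.1.1 fun h0 ↦ hsT.2 ?_
    rw [← h0]; simpa [γ] using hx
  have hlt (t : ℝ) (h0 : 0 ≤ t) (ht : t < s) : γ t ∈ G := by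
    by_contra h1
    exact absurd (csInf_le hTb ⟨⟨h0, ht.le.trans hsT.1.2⟩, h1⟩) (not_le.2 ht)
  have hcl : ∀ t ∈ Icc 0 s, γ t ∈ closure G := by
    have h1 : Icc 0 s ⊆ closure (Ico 0 s) := by rw [closure_Ico hs0.ne]
    intro t ht
    exact closure_mono (image_subset_iff.2 fun t ht ↦ hlt t ht.1 ht.2 : γ '' Ico 0 s ⊆ G)
      (image_closure_subset_closure_image hγ (mem_image_of_mem γ (h1 ht)))
  refine ⟨γ s, ?_, hsT.2, hcl s ⟨hs0.le, le_rfl⟩, ?_⟩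
  · rw [segment_eq_image_lineMap]; exact mem_image_of_mem _ hsT.1
  · rw [segment_eq_image_lineMap]
    rintro _ ⟨t, ht, rfl⟩
    have h1 : AffineMap.lineMap x (γ s) t = γ (t * s) := by
      simp only [γ, AffineMap.lineMap_apply, vsub_eq_sub, vadd_eq_add, add_sub_cancel_right,
        smul_smul]
    rw [h1]
    exact hcl _ ⟨mul_nonneg ht.1 hs0.le, mul_le_of_le_one_left hs0.le ht.2⟩

/-- The second derivative of a Killing field is controlled by its 1-jet: since it is symmetric in
two arguments and, after lowering an index, skew in two others up to lower-order terms, it can be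
solved for as in the formula for the Christoffel symbols. -/
lemma abs_metric_fderiv_fderiv_le {g : E → E →L[ℝ] E →L[ℝ] ℝ} {ξ : E → E} {x : E}
    (hg : ContDiffAt ℝ ∞ g x) (hξ : ContDiffAt ℝ ∞ ξ x) (hsymm : ∀ v w, g x v w = g x w v)
    (hkill : ∀ᶠ z in 𝓝 x, ∀ v w, lieDerivMetric g ξ z v w = 0) {m : ℝ}
    (h1 : ‖fderiv ℝ g x‖ ≤ m) (h2 : ‖fderiv ℝ (fderiv ℝ g) x‖ ≤ m) (u v w : E) :
    |g x (fderiv ℝ (fderiv ℝ ξ) x u v) w|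
      ≤ 6 * m * (‖ξ x‖ + ‖fderiv ℝ ξ x‖) * ‖u‖ * ‖v‖ * ‖w‖ := by
  have dg : DifferentiableAt ℝ g x := hg.differentiableAt (by simp)
  have dξ : DifferentiableAt ℝ ξ x := hξ.differentiableAt (by simp)
  have ddg : DifferentiableAt ℝ (fderiv ℝ g) x :=
    (hg.fderiv_right (m := ∞) (by simp)).differentiableAt (by simp)
  have ddξ : DifferentiableAt ℝ (fderiv ℝ ξ) x :=
    (hξ.fderiv_right (m := ∞) (by simp)).differentiableAt (by simp)
  have c (c : E) : DifferentiableAt ℝ (fun _ : E ↦ c) x := differentiableAt_const c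
  -- the lower-order terms in the derivative of the Killing equation
  let L (u v w : E) : ℝ := fderiv ℝ (fderiv ℝ g) x u (ξ x) v w
    + fderiv ℝ g x (fderiv ℝ ξ x u) v w + fderiv ℝ g x u (fderiv ℝ ξ x v) w
    + fderiv ℝ g x u v (fderiv ℝ ξ x w)
  have key (u v w : E) : g x (fderiv ℝ (fderiv ℝ ξ) x u v) w
      + g x (fderiv ℝ (fderiv ℝ ξ) x u w) v = - L u v w := by
    have e : (fun z ↦ lieDerivMetric g ξ z v w) =ᶠ[𝓝 x] fun _ ↦ 0 := by
      filter_upwards [hkill] with z hz using hz v w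
    have e2 := congrArg (fun L : E →L[ℝ] ℝ ↦ L u) e.fderiv_eq
    have dv := ddξ.clm_apply (c v)
    have dw := ddξ.clm_apply (c w)
    have d1 := ((ddg.clm_apply dξ).clm_apply (c v)).clm_apply (c w)
    have d2 := (dg.clm_apply dv).clm_apply (c w)
    have d3 := (dg.clm_apply (c v)).clm_apply dw
    unfold lieDerivMetric at e2
    rw [fderiv_fun_add (d1.fun_add d2) d3, fderiv_fun_add d1 d2] at e2
    simp only [fderiv_clm_apply_apply ((ddg.clm_apply dξ).clm_apply (c v)) (c w),
      fderiv_clm_apply_apply (ddg.clm_apply dξ) (c v), fderiv_clm_apply_apply ddg dξ,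
      fderiv_clm_apply_apply (dg.clm_apply dv) (c w), fderiv_clm_apply_apply dg dv,
      fderiv_clm_apply_apply ddξ (c _),
      fderiv_clm_apply_apply (dg.clm_apply (c v)) dw, fderiv_clm_apply_apply dg (c v),
      fderiv_fun_const, _root_.add_apply, Pi.zero_apply, _root_.zero_apply, map_zero,
      add_zero] at e2
    simp only [L]
    rw [hsymm (fderiv ℝ (fderiv ℝ ξ) x u w) v]
    linarith
  have sym (a b : E) : fderiv ℝ (fderiv ℝ ξ) x a b = fderiv ℝ (fderiv ℝ ξ) x b a :=
    (hξ.isSymmSndFDerivAt (by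
      rw [minSmoothness_of_isRCLikeNormedField]
      exact WithTop.coe_le_coe.2 (le_top : (2 : ℕ∞) ≤ ⊤))).eq a b
  set N := ‖ξ x‖ + ‖fderiv ℝ ξ x‖ with hN
  have hξN : ‖ξ x‖ ≤ N := by simp [hN]
  have hdN : ‖fderiv ℝ ξ x‖ ≤ N := by simp [hN]
  have hm : 0 ≤ m := (norm_nonneg _).trans h1
  have hN0 : 0 ≤ N := (norm_nonneg _).trans hξN
  have tri (B : E →L[ℝ] E →L[ℝ] E →L[ℝ] ℝ) (hB : ‖B‖ ≤ m) (a b c : E) :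
      |B a b c| ≤ m * ‖a‖ * ‖b‖ * ‖c‖ := by
    calc |B a b c| = ‖B a b c‖ := rfl
      _ ≤ ‖B a b‖ * ‖c‖ := ContinuousLinearMap.le_opNorm _ _
      _ ≤ (‖B a‖ * ‖b‖) * ‖c‖ := by gcongr; exact ContinuousLinearMap.le_opNorm _ _
      _ ≤ ((‖B‖ * ‖a‖) * ‖b‖) * ‖c‖ := by gcongr; exact ContinuousLinearMap.le_opNorm _ _
      _ ≤ _ := by gcongr
  have dle (a : E) : ‖fderiv ℝ ξ x a‖ ≤ N * ‖a‖ :=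
    (ContinuousLinearMap.le_opNorm _ _).trans (by gcongr)
  have Lle (u v w : E) : |L u v w| ≤ m * N * ‖u‖ * ‖v‖ * ‖w‖ + 3 * (m * N * ‖u‖ * ‖v‖ * ‖w‖) := by
    have a1 : |fderiv ℝ (fderiv ℝ g) x u (ξ x) v w| ≤ m * N * ‖u‖ * ‖v‖ * ‖w‖ := by
      have hB : ‖fderiv ℝ (fderiv ℝ g) x u‖ ≤ m * ‖u‖ :=
        (ContinuousLinearMap.le_opNorm _ _).trans (by gcongr)
      calc |fderiv ℝ (fderiv ℝ g) x u (ξ x) v w|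
          = ‖fderiv ℝ (fderiv ℝ g) x u (ξ x) v w‖ := rfl
        _ ≤ ‖fderiv ℝ (fderiv ℝ g) x u (ξ x) v‖ * ‖w‖ := ContinuousLinearMap.le_opNorm _ _
        _ ≤ (‖fderiv ℝ (fderiv ℝ g) x u (ξ x)‖ * ‖v‖) * ‖w‖ := by
          gcongr; exact ContinuousLinearMap.le_opNorm _ _
        _ ≤ ((‖fderiv ℝ (fderiv ℝ g) x u‖ * ‖ξ x‖) * ‖v‖) * ‖w‖ := by
          gcongr; exact ContinuousLinearMap.le_opNorm _ _
        _ ≤ ((m * ‖u‖ * N) * ‖v‖) * ‖w‖ := by gcongr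
        _ = _ := by ring
    have a2 : |fderiv ℝ g x (fderiv ℝ ξ x u) v w| ≤ m * N * ‖u‖ * ‖v‖ * ‖w‖ :=
      (tri _ h1 _ _ _).trans (by
        calc _ ≤ m * (N * ‖u‖) * ‖v‖ * ‖w‖ := by gcongr; exact dle u
          _ = _ := by ring)
    have a3 : |fderiv ℝ g x u (fderiv ℝ ξ x v) w| ≤ m * N * ‖u‖ * ‖v‖ * ‖w‖ :=
      (tri _ h1 _ _ _).trans (by
        calc _ ≤ m * ‖u‖ * (N * ‖v‖) * ‖w‖ := by gcongr; exact dle v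
          _ = _ := by ring)
    have a4 : |fderiv ℝ g x u v (fderiv ℝ ξ x w)| ≤ m * N * ‖u‖ * ‖v‖ * ‖w‖ :=
      (tri _ h1 _ _ _).trans (by
        calc _ ≤ m * ‖u‖ * ‖v‖ * (N * ‖w‖) := by gcongr; exact dle w
          _ = _ := by ring)
    rw [abs_le] at *
    constructor <;> simp only [L] <;> linarith
  -- by symmetry of the second derivative of `ξ`, a signed sum of three permuted equations isolates
  -- `g(ξ''(u, v), w)`, as for the Christoffel symbols
  have e1 := key u v w
  have e2 := key w u v
  have e3 := key v w u
  rw [sym w u, sym w v] at e2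
  rw [sym v u] at e3
  have l1 := abs_le.1 (Lle u v w)
  have l2 := abs_le.1 (Lle w u v)
  have l3 := abs_le.1 (Lle v w u)
  have p1 : m * N * ‖w‖ * ‖u‖ * ‖v‖ = m * N * ‖u‖ * ‖v‖ * ‖w‖ := by ring
  have p2 : m * N * ‖v‖ * ‖w‖ * ‖u‖ = m * N * ‖u‖ * ‖v‖ * ‖w‖ := by ring
  rw [p1] at l2
  rw [p2] at l3
  have p3 : 6 * m * N * ‖u‖ * ‖v‖ * ‖w‖ = 6 * (m * N * ‖u‖ * ‖v‖ * ‖w‖) := by ring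
  rw [p3, abs_le]
  constructor <;> linarith [l1.1, l1.2, l2.1, l2.2, l3.1, l3.2]

variable [FiniteDimensional ℝ E]

namespace KillingChart
variable {Ω : Set E} {g : E → E →L[ℝ] E →L[ℝ] ℝ} {J S : E → E →L[ℝ] E} {μ : E → ℝ}
  {Γ : E → E →ₗ[ℝ] E →ₗ[ℝ] E} (h : KillingChart Ω g J S μ Γ) {x : E} (hx : x ∈ Ω)

include h hx

lemma contDiffAt_J_gradient : ContDiffAt ℝ ∞ (fun z ↦ J z (gradient g μ z)) x :=
  (h.contDiffAt_J hx).clm_apply (h.contDiffAt_gradient hx)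

/-- On the closure of the regular points the rotated gradient obeys a closed system of first-order
linear differential equations together with its derivative, with locally bounded coefficients. -/
lemma exists_norm_fderiv_fderiv_le : ∃ r > 0, ∃ C, Metric.ball x r ⊆ Ω ∧
    ∀ z ∈ Metric.ball x r, z ∈ closure {y ∈ Ω | fderiv ℝ μ y ≠ 0} →
      ‖fderiv ℝ (fderiv ℝ fun y ↦ J y (gradient g μ y)) z‖
        ≤ C * (‖J z (gradient g μ z)‖ + ‖fderiv ℝ (fun y ↦ J y (gradient g μ y)) z‖) := by
  set ξ : E → E := fun y ↦ J y (gradient g μ y) with hξ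
  have c1 := (continuousAt_norm_fderiv (h.contDiffAt_g hx)).1
  have c2 := (continuousAt_norm_fderiv (h.contDiffAt_g hx)).2
  have c3 : ContinuousAt (fun z ↦ ‖(g z).inverse‖) x := (h.contDiffAt_inverse hx).continuousAt.norm
  set m := max (‖fderiv ℝ g x‖ + 1) (‖fderiv ℝ (fderiv ℝ g) x‖ + 1)
  set k := ‖(g x).inverse‖ + 1
  have e1 := c1.eventually_lt_const (show ‖fderiv ℝ g x‖ < m from
    (lt_add_one _).trans_le (le_max_left _ _))
  have e2 := c2.eventually_lt_const (show ‖fderiv ℝ (fderiv ℝ g) x‖ < m from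
    (lt_add_one _).trans_le (le_max_right _ _))
  have e3 := c3.eventually_lt_const (show ‖(g x).inverse‖ < k from lt_add_one _)
  obtain ⟨r, hr, hball⟩ := Metric.eventually_nhds_iff_ball.1
    (((h.mem_nhds hx).and e1).and (e2.and e3))
  refine ⟨r, hr, k * (6 * m), fun z hz ↦ (hball z hz).1.1, ?_⟩
  have reg : ∀ z ∈ Metric.ball x r, z ∈ {y ∈ Ω | fderiv ℝ μ y ≠ 0} →
      ‖fderiv ℝ (fderiv ℝ ξ) z‖ ≤ k * (6 * m) * (‖ξ z‖ + ‖fderiv ℝ ξ z‖) := by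
    intro z hz hzV
    obtain ⟨⟨hzΩ, b1⟩, b2, b3⟩ := hball z hz
    have kill : ∀ᶠ y in 𝓝 z, ∀ v w, lieDerivMetric g ξ y v w = 0 := by
      filter_upwards [h.eventually_regular hzΩ hzV.2] with y hy v w
      exact h.lieDerivMetric_J_gradient hy.1 hy.2 v w
    have est := abs_metric_fderiv_fderiv_le (h.contDiffAt_g hzΩ) (h.contDiffAt_J_gradient hzΩ)
      (h.g_symm z hzΩ) kill b1.le b2.le
    have hm : 0 ≤ m := (norm_nonneg _).trans b1.le
    have hk : 0 ≤ k := (norm_nonneg _).trans b3.le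
    refine ContinuousLinearMap.opNorm_le_bound₂ _ (by positivity) fun u v ↦ ?_
    have f1 : ‖g z (fderiv ℝ (fderiv ℝ ξ) z u v)‖
        ≤ 6 * m * (‖ξ z‖ + ‖fderiv ℝ ξ z‖) * ‖u‖ * ‖v‖ :=
      ContinuousLinearMap.opNorm_le_bound _ (by positivity) fun w ↦ est u v w
    rw [← h.inverse_g hzΩ (fderiv ℝ (fderiv ℝ ξ) z u v)]
    calc _ ≤ ‖(g z).inverse‖ * ‖g z (fderiv ℝ (fderiv ℝ ξ) z u v)‖ :=
          ContinuousLinearMap.le_opNorm _ _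
      _ ≤ k * (6 * m * (‖ξ z‖ + ‖fderiv ℝ ξ z‖) * ‖u‖ * ‖v‖) := by gcongr
      _ = _ := by ring
  intro z hz hzV
  have hzΩ := (hball z hz).1.1
  have hne := mem_closure_iff_nhdsWithin_neBot.1 hzV
  have d1 : ContDiffAt ℝ ∞ (fderiv ℝ ξ) z :=
    (h.contDiffAt_J_gradient hzΩ).fderiv_right (by simp)
  have d2 : ContDiffAt ℝ ∞ (fderiv ℝ (fderiv ℝ ξ)) z := d1.fderiv_right (by simp)
  have t1 : Tendsto (fun y ↦ ‖fderiv ℝ (fderiv ℝ ξ) y‖) (𝓝[{y ∈ Ω | fderiv ℝ μ y ≠ 0}] z)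
    (𝓝 ‖fderiv ℝ (fderiv ℝ ξ) z‖) := d2.continuousAt.norm.tendsto.mono_left nhdsWithin_le_nhds
  have t2 : Tendsto (fun y ↦ k * (6 * m) * (‖ξ y‖ + ‖fderiv ℝ ξ y‖))
      (𝓝[{y ∈ Ω | fderiv ℝ μ y ≠ 0}] z) (𝓝 (k * (6 * m) * (‖ξ z‖ + ‖fderiv ℝ ξ z‖))) :=
    (((h.contDiffAt_J_gradient hzΩ).continuousAt.norm.add
      d1.continuousAt.norm).const_mul _).tendsto.mono_left nhdsWithin_le_nhds
  refine le_of_tendsto_of_tendsto t1 t2 ?_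
  filter_upwards [self_mem_nhdsWithin,
    mem_nhdsWithin_of_mem_nhds (Metric.isOpen_ball.mem_nhds hz)] with y hy1 hy2
  exact reg y hy2 hy1

/-- Unique continuation for the gradient of `μ` along segments in the closure of the regular
points. -/
lemma exists_unique_continuation : ∃ r > 0, Metric.ball x r ⊆ Ω ∧
    ∀ a ∈ Metric.ball x r, ∀ b ∈ Metric.ball x r,
      segment ℝ a b ⊆ closure {y ∈ Ω | fderiv ℝ μ y ≠ 0} →
      fderiv ℝ μ a = 0 → fderiv ℝ (fderiv ℝ μ) a = 0 → fderiv ℝ μ b = 0 := by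
  obtain ⟨r, hr, C, hΩ, hC⟩ := h.exists_norm_fderiv_fderiv_le hx
  refine ⟨r, hr, hΩ, fun a ha b hb hseg h1 h2 ↦ ?_⟩
  set ξ : E → E := fun y ↦ J y (gradient g μ y) with hξ
  have hsub : segment ℝ a b ⊆ Metric.ball x r := (convex_ball x r).segment_subset ha hb
  have d0 (z : E) (hz : z ∈ Metric.ball x r) : DifferentiableAt ℝ ξ z :=
    (h.contDiffAt_J_gradient (hΩ hz)).differentiableAt (by simp)
  have d1 (z : E) (hz : z ∈ Metric.ball x r) : DifferentiableAt ℝ (fderiv ℝ ξ) z :=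
    ((h.contDiffAt_J_gradient (hΩ hz)).fderiv_right (m := ∞) (by simp)).differentiableAt (by simp)
  have haΩ := hΩ ha
  have ga : gradient g μ a = 0 := (h.gradient_eq_zero_iff haΩ).2 h1
  have dga : fderiv ℝ (gradient g μ) a = 0 := by
    ext v
    have e : g a (fderiv ℝ (gradient g μ) a v) = 0 := by
      ext w
      have := h.hess_eq haΩ v w
      rw [ga, map_zero, add_zero, hess, h1, h2] at this
      simpa using this
    rw [← h.inverse_g haΩ (fderiv ℝ (gradient g μ) a v), e, map_zero]
    rfl
  have ξa : ξ a = 0 := by simp [hξ, ga]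
  have dξa : fderiv ℝ ξ a = 0 := by
    ext v
    rw [hξ, fderiv_clm_apply_apply (h.diff_J haΩ) (h.diff_gradient haΩ), ga, dga]
    simp
  have key := eq_zero_of_norm_fderiv_le (F := fun z ↦ (ξ z, fderiv ℝ ξ z)) (a := a) (b := b)
    (C := max 1 (2 * max C 0)) (fun z hz ↦ (d0 z (hsub hz)).prodMk (d1 z (hsub hz)))
    (fun z hz ↦ by
      have hz' := hsub hz
      rw [DifferentiableAt.fderiv_prodMk (d0 z hz') (d1 z hz')]
      refine (ContinuousLinearMap.opNorm_prod _ _).trans_le ?_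
      set F : E × (E →L[ℝ] E) := (ξ z, fderiv ℝ ξ z) with hF
      have n1 : ‖ξ z‖ ≤ ‖F‖ := norm_fst_le F
      have n2 : ‖fderiv ℝ ξ z‖ ≤ ‖F‖ := norm_snd_le F
      have n3 := hC z hz' (hseg hz)
      refine max_le ?_ ?_
      · calc ‖fderiv ℝ ξ z‖ ≤ 1 * ‖F‖ := by rw [one_mul]; exact n2
          _ ≤ _ := by gcongr; exact le_max_left _ _
      · calc _ ≤ C * (‖ξ z‖ + ‖fderiv ℝ ξ z‖) := n3
          _ ≤ max C 0 * (‖F‖ + ‖F‖) := by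
            gcongr
            exact le_max_left _ _
          _ = 2 * max C 0 * ‖F‖ := by ring
          _ ≤ _ := by gcongr; exact le_max_right _ _)
    (by rw [ξa, dξa]; rfl)
  have hb0 : ξ b = 0 := congrArg Prod.fst key
  rw [← h.gradient_eq_zero_iff (hΩ hb)]
  have := h.J_sq b (hΩ hb) (gradient g μ b)
  rw [show J b (gradient g μ b) = 0 from hb0, map_zero] at this
  exact neg_eq_zero.1 this.symm

end KillingChart

end UniqueContinuation

/-! ### Critical points of the eigenvalue -/

section CriticalPoints

open Filter Topology Module

variable {E : Type*} [NormedAddCommGroup E] [NormedSpace ℝ E]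

/-- A punctured ball in a space of dimension at least two is connected: it is the image of the
punctured space under a radial contraction. -/
lemma isPreconnected_ball_diff_zero (hE : 1 < Module.rank ℝ E) {ε : ℝ} (hε : 0 < ε) :
    IsPreconnected (Metric.ball (0 : E) ε \ {0}) := by
  have hne (x : E) : 1 + ‖x‖ ≠ 0 := by positivity
  have hc : Continuous fun x : E ↦ (ε / (1 + ‖x‖)) • x :=
    (continuous_const.div (by fun_prop) hne).smul continuous_id
  have himg : Metric.ball (0 : E) ε \ {0} = (fun x : E ↦ (ε / (1 + ‖x‖)) • x) '' {0}ᶜ := by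
    ext y
    constructor
    · rintro ⟨hy, hy0⟩
      rw [mem_ball_zero_iff] at hy
      have hpos : 0 < ε - ‖y‖ := by linarith
      refine ⟨(ε - ‖y‖)⁻¹ • y, ?_, ?_⟩
      · simpa [hpos.ne'] using hy0
      · simp only [norm_smul, norm_inv, Real.norm_of_nonneg hpos.le, smul_smul]
        have : ε / (1 + (ε - ‖y‖)⁻¹ * ‖y‖) * (ε - ‖y‖)⁻¹ = 1 := by
          have h1 : 1 + (ε - ‖y‖)⁻¹ * ‖y‖ = ε / (ε - ‖y‖) := by field_simp; ring
          rw [h1]; field_simp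
        rw [this, one_smul]
    · rintro ⟨x, hx, rfl⟩
      have hx0 : x ≠ 0 := hx
      have hp : 0 < 1 + ‖x‖ := by positivity
      refine ⟨?_, ?_⟩
      · rw [mem_ball_zero_iff, norm_smul, Real.norm_of_nonneg (by positivity), div_mul_eq_mul_div,
          div_lt_iff₀ hp]
        nlinarith
      · simp [hx0, hε.ne', hp.ne']
  rw [himg]
  exact ((isPathConnected_compl_singleton_of_one_lt_rank hE 0).isConnected.isPreconnected.image _
    hc.continuousOn)

variable [FiniteDimensional ℝ E]

/-- The zero set of a submersion to a space of dimension at least two does not disconnect small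
neighbourhoods of its points. -/
lemma exists_isPreconnected_diff_zeros {F : Type*} [NormedAddCommGroup F] [NormedSpace ℝ F]
    [FiniteDimensional ℝ F] (hF : 1 < Module.rank ℝ F) {f : E → F} {f' : E →L[ℝ] F} {y : E}
    (hf : HasStrictFDerivAt f f' y) (hf' : (f' : E →ₗ[ℝ] F).range = ⊤) (hy : f y = 0) {U : Set E}
    (hU : U ∈ 𝓝 y) :
    ∃ N, IsOpen N ∧ y ∈ N ∧ N ⊆ U ∧ IsPreconnected (N \ {z | f z = 0}) ∧
      N ⊆ closure (N \ {z | f z = 0}) := by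
  have := FiniteDimensional.complete ℝ E
  have := FiniteDimensional.complete ℝ F
  -- coordinates in which `f` is the projection to the first factor
  let Φ := hf.implicitToOpenPartialHomeomorph f f' hf'
  have hΦ (x : E) : (Φ x).1 = f x := hf.implicitToOpenPartialHomeomorph_fst hf' x
  have hys : y ∈ Φ.source := hf.mem_implicitToOpenPartialHomeomorph_source hf'
  have hyt : Φ y ∈ Φ.target := Φ.map_source hys
  set c := (Φ y).2
  have hΦy : Φ y = (0, c) := Prod.ext (by rw [hΦ, hy]) rfl
  have hnhds : Φ.target ∩ Φ.symm ⁻¹' U ∈ 𝓝 ((0, c) : F × f'.ker) := by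
    rw [← hΦy]
    refine inter_mem (Φ.open_target.mem_nhds hyt) ?_
    refine (Φ.continuousAt_symm hyt).preimage_mem_nhds ?_
    rwa [Φ.left_inv hys]
  obtain ⟨ε, hε, hball⟩ := Metric.mem_nhds_iff.1 hnhds
  rw [← ball_prod_same] at hball
  set B := Metric.ball (0 : F) ε ×ˢ Metric.ball c ε with hB
  set B' := (Metric.ball (0 : F) ε \ {0}) ×ˢ Metric.ball c ε with hB'
  have hBt : B ⊆ Φ.target := fun p hp ↦ (hball hp).1
  have hB'B : B' ⊆ B := prod_mono_left sdiff_subset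
  have hdiff : Φ.symm '' B \ {z | f z = 0} = Φ.symm '' B' := by
    ext z
    constructor
    · rintro ⟨⟨p, hp, rfl⟩, hz⟩
      refine ⟨p, ⟨⟨hp.1, fun h0 ↦ hz ?_⟩, hp.2⟩, rfl⟩
      change f _ = 0
      rw [← hΦ, Φ.right_inv (hBt hp)]
      exact h0
    · rintro ⟨p, hp, rfl⟩
      refine ⟨⟨p, hB'B hp, rfl⟩, fun hz ↦ hp.1.2 ?_⟩
      change f _ = 0 at hz
      rwa [← hΦ, Φ.right_inv (hBt (hB'B hp))] at hz
  refine ⟨Φ.symm '' B, ?_, ⟨Φ y, ?_, Φ.left_inv hys⟩, ?_, ?_, ?_⟩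
  · exact Φ.symm.isOpen_image_of_subset_source (Metric.isOpen_ball.prod Metric.isOpen_ball) hBt
  · rw [hΦy]
    exact ⟨Metric.mem_ball_self hε, Metric.mem_ball_self hε⟩
  · rintro _ ⟨p, hp, rfl⟩
    exact (hball hp).2
  · rw [hdiff]
    refine ((isPreconnected_ball_diff_zero hF hε).prod
      (convex_ball c ε).isPreconnected).image _ ?_
    exact Φ.symm.continuousOn.mono (hB'B.trans hBt)
  · rw [hdiff]
    have : Nontrivial F := rank_pos_iff_nontrivial.1 (zero_lt_one.trans hF)
    have hcl : B ⊆ closure B' := by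
      rw [hB', closure_prod_eq]
      refine prod_mono ?_ subset_closure
      have := (dense_compl_singleton (0 : F)).open_subset_closure_inter
        (Metric.isOpen_ball (x := (0 : F)) (ε := ε))
      rwa [← sdiff_eq] at this
    rintro _ ⟨p, hp, rfl⟩
    exact ((Φ.continuousAt_symm (hBt hp)).continuousWithinAt).mem_closure_image (hcl hp)

namespace KillingChart
variable {Ω : Set E} {g : E → E →L[ℝ] E →L[ℝ] ℝ} {J S : E → E →L[ℝ] E} {μ : E → ℝ}
  {Γ : E → E →ₗ[ℝ] E →ₗ[ℝ] E} (h : KillingChart Ω g J S μ Γ) {x : E} (hx : x ∈ Ω)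

include h

lemma isOpen_regular : IsOpen {y ∈ Ω | fderiv ℝ μ y ≠ 0} :=
  isOpen_iff_mem_nhds.2 fun _ hz ↦ h.eventually_regular hz.1 hz.2

include hx

/-- Near a nondegenerate critical point of `μ` regular points are dense. -/
lemma mem_interior_closure_of_fderiv_fderiv_ne_zero (h2 : fderiv ℝ (fderiv ℝ μ) x ≠ 0) :
    x ∈ interior (closure {y ∈ Ω | fderiv ℝ μ y ≠ 0}) := by
  have c2 : ContDiffAt ℝ ∞ (fderiv ℝ (fderiv ℝ μ)) x :=
    (h.contDiffAt_dmu hx).fderiv_right (by simp)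
  rw [mem_interior_iff_mem_nhds]
  filter_upwards [h.mem_nhds hx, c2.continuousAt.eventually_ne h2] with z hz hz2
  by_contra hz3
  have h0 : fderiv ℝ μ =ᶠ[𝓝 z] fun _ ↦ 0 := by
    filter_upwards [h.mem_nhds hz, isClosed_closure.isOpen_compl.mem_nhds hz3] with w hw hw2
    by_contra hw3
    exact hw2 (subset_closure ⟨hw, hw3⟩)
  apply hz2
  rw [h0.fderiv_eq]
  simp

/-- The closure of the set of regular points is relatively open. -/
lemma mem_interior_closure (hcl : x ∈ closure {y ∈ Ω | fderiv ℝ μ y ≠ 0}) :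
    x ∈ interior (closure {y ∈ Ω | fderiv ℝ μ y ≠ 0}) := by
  set V := {y ∈ Ω | fderiv ℝ μ y ≠ 0} with hV
  by_contra hxG
  have hVG : V ⊆ interior (closure V) := interior_maximal subset_closure h.isOpen_regular
  obtain ⟨r, hr, hΩ, huc⟩ := h.exists_unique_continuation hx
  obtain ⟨z, hzV, hzr⟩ := Metric.mem_closure_iff.1 hcl r hr
  have hzb : z ∈ Metric.ball x r := by rwa [Metric.mem_ball, dist_comm]
  -- move from a regular point `z` towards `x`: at the first point `p` outside the interior of the
  -- closure both `dμ` and its derivative vanish, so unique continuation back to `z` applies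
  obtain ⟨p, hp, hpG, -, hseg⟩ := exists_first_exit isOpen_interior (hVG hzV) hxG
  have hpb : p ∈ Metric.ball x r :=
    (convex_ball x r).segment_subset hzb (Metric.mem_ball_self hr) hp
  have hcc : closure (interior (closure V)) ⊆ closure V :=
    closure_minimal interior_subset isClosed_closure
  have h1 : fderiv ℝ μ p = 0 := by
    by_contra h0
    exact hpG (hVG ⟨hΩ hpb, h0⟩)
  have h2 : fderiv ℝ (fderiv ℝ μ) p = 0 := by
    by_contra h0
    exact hpG (h.mem_interior_closure_of_fderiv_fderiv_ne_zero (hΩ hpb) h0)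
  exact hzV.2 (huc p hpb z hzb (by rw [segment_symm]; exact hseg.trans hcc) h1 h2)

/-- At a critical point of `μ` in the closure of the regular points the second derivative of `μ`
does not vanish. -/
lemma fderiv_fderiv_ne_zero (hcl : x ∈ closure {y ∈ Ω | fderiv ℝ μ y ≠ 0})
    (h1 : fderiv ℝ μ x = 0) : fderiv ℝ (fderiv ℝ μ) x ≠ 0 := by
  intro h2
  have hint := h.mem_interior_closure hx hcl
  obtain ⟨r, hr, hΩ, huc⟩ := h.exists_unique_continuation hx
  obtain ⟨s, hs, hball⟩ := Metric.mem_nhds_iff.1 (mem_interior_iff_mem_nhds.1 hint)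
  obtain ⟨z, hzV, hz⟩ := Metric.mem_closure_iff.1 hcl (min r s) (lt_min hr hs)
  rw [dist_comm] at hz
  exact hzV.2 (huc x (Metric.mem_ball_self hr) z (hz.trans_le (min_le_left _ _))
    (((convex_ball x s).segment_subset (Metric.mem_ball_self hs)
      (hz.trans_le (min_le_right _ _))).trans hball) h1 h2)

/-- At a critical point of `μ` in the closure of the regular points the second derivative of `μ`
is `J`-invariant, by continuity of the Killing equation. -/
lemma fderiv_fderiv_J (hcl : x ∈ closure {y ∈ Ω | fderiv ℝ μ y ≠ 0})
    (h1 : fderiv ℝ μ x = 0) (v w : E) :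
    fderiv ℝ (fderiv ℝ μ) x (J x v) w = - fderiv ℝ (fderiv ℝ μ) x v (J x w) := by
  set ξ : E → E := fun y ↦ J y (gradient g μ y) with hξ
  have dg := (h.contDiffAt_g hx).fderiv_right (m := ∞) (by simp)
  have cξ := h.contDiffAt_J_gradient hx
  have dξ := cξ.fderiv_right (m := ∞) (by simp)
  have cont : ContinuousAt (fun z ↦ lieDerivMetric g ξ z v w) x := by
    unfold lieDerivMetric
    have k (c : E) : ContinuousAt (fun _ : E ↦ c) x := continuousAt_const
    have d1 : ContinuousAt (fun z ↦ fderiv ℝ g z (ξ z) v w) x :=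
      ((dg.continuousAt.clm_apply cξ.continuousAt).clm_apply (k v)).clm_apply (k w)
    have d2 : ContinuousAt (fun z ↦ g z (fderiv ℝ ξ z v) w) x :=
      ((h.contDiffAt_g hx).continuousAt.clm_apply (dξ.continuousAt.clm_apply (k v))).clm_apply (k w)
    have d3 : ContinuousAt (fun z ↦ g z v (fderiv ℝ ξ z w)) x :=
      ((h.contDiffAt_g hx).continuousAt.clm_apply (k v)).clm_apply (dξ.continuousAt.clm_apply (k w))
    exact (d1.add d2).add d3
  have hne := mem_closure_iff_nhdsWithin_neBot.1 hcl
  have kill : lieDerivMetric g ξ x v w = 0 := by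
    refine tendsto_nhds_unique (cont.tendsto.mono_left
      (nhdsWithin_le_nhds (s := {y ∈ Ω | fderiv ℝ μ y ≠ 0}))) ?_
    refine tendsto_const_nhds.congr' ?_
    filter_upwards [self_mem_nhdsWithin] with y hy
    exact (h.lieDerivMetric_J_gradient hy.1 hy.2 v w).symm
  have gx : gradient g μ x = 0 := (h.gradient_eq_zero_iff hx).2 h1
  have hess0 (v w : E) : g x (fderiv ℝ (gradient g μ) x v) w = fderiv ℝ (fderiv ℝ μ) x v w := by
    have := h.hess_eq hx v w
    rwa [gx, map_zero, add_zero, hess, h1, _root_.zero_apply, sub_zero] at this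
  have dξ' (v : E) : fderiv ℝ ξ x v = J x (fderiv ℝ (gradient g μ) x v) := by
    rw [hξ, fderiv_clm_apply_apply (h.diff_J hx) (h.diff_gradient hx), gx, map_zero, zero_add]
  have ξ0 : ξ x = 0 := by simp [hξ, gx]
  have e1 := h.g_J_right hx (fderiv ℝ (gradient g μ) x v) w
  have e2 := h.g_J_right hx (fderiv ℝ (gradient g μ) x w) v
  have sym := ((h.contDiffAt_mu hx).isSymmSndFDerivAt
    (by rw [minSmoothness_of_isRCLikeNormedField]
        exact WithTop.coe_le_coe.2 (le_top : (2 : ℕ∞) ≤ ⊤))).eq (J x v) w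
  rw [lieDerivMetric, ξ0, map_zero, dξ', dξ', h.g_symm x hx v] at kill
  rw [hess0] at e1 e2
  simp only [_root_.zero_apply, zero_add] at kill
  rw [sym]
  linarith

/-- Every point in the closure of the regular points has small neighbourhoods in which the
regular points contain a connected dense subset: the critical points lie in a submanifold of
codimension two. -/
lemma exists_isPreconnected_regular (hcl : x ∈ closure {y ∈ Ω | fderiv ℝ μ y ≠ 0}) :
    ∃ N, IsOpen N ∧ x ∈ N ∧ N ⊆ Ω ∧ ∃ W ⊆ N, W ⊆ {y ∈ Ω | fderiv ℝ μ y ≠ 0} ∧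
      IsPreconnected W ∧ N ⊆ closure W := by
  by_cases h1 : fderiv ℝ μ x = 0
  · have h2 := h.fderiv_fderiv_ne_zero hx hcl h1
    have hJ := h.fderiv_fderiv_J hx hcl h1
    set H := fderiv ℝ (fderiv ℝ μ) x with hH
    obtain ⟨v, hv⟩ : ∃ v, H v ≠ 0 := by
      by_contra! hv
      exact h2 (by ext a b; rw [hv]; rfl)
    have sym (a b : E) : H a b = H b a := ((h.contDiffAt_mu hx).isSymmSndFDerivAt
      (by rw [minSmoothness_of_isRCLikeNormedField]
          exact WithTop.coe_le_coe.2 (le_top : (2 : ℕ∞) ≤ ⊤))).eq a b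
    -- the differential of `μ` in the two directions `v` and `J v`
    let f : E → ℝ × ℝ := fun z ↦ (fderiv ℝ μ z v, fderiv ℝ μ z (J x v))
    let f' : E →L[ℝ] ℝ × ℝ := (H v).prod (H (J x v))
    have hf : HasStrictFDerivAt f f' x := by
      have hs : HasStrictFDerivAt (fderiv ℝ μ) H x :=
        (h.contDiffAt_dmu hx).hasStrictFDerivAt (by simp)
      have key (a : E) : HasStrictFDerivAt (fun z ↦ fderiv ℝ μ z a) (H a) x := by
        have := hs.clm_apply (hasStrictFDerivAt_const a x)
        convert! this using 1
        ext b
        simp [sym a b]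
      exact (key v).prodMk (key (J x v))
    have hrange : (f' : E →ₗ[ℝ] ℝ × ℝ).range = ⊤ := by
      obtain ⟨w, hw⟩ : ∃ w, H v w ≠ 0 := by
        by_contra! hw
        exact hv (by ext a; rw [hw]; rfl)
      set p := H v w
      set q := H v (J x w)
      -- by `J`-invariance `f'` has a matrix of rotation type on the span of `w` and `J w`
      have e1 : f' w = (p, -q) := by
        change (H v w, H (J x v) w) = _
        rw [hJ]
      have e2 : f' (J x w) = (q, p) := by
        change (H v (J x w), H (J x v) (J x w)) = _
        rw [hJ, h.J_sq x hx, map_neg, neg_neg]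
      have hd : p ^ 2 + q ^ 2 ≠ 0 := by positivity
      rw [LinearMap.range_eq_top]
      rintro ⟨s, t⟩
      refine ⟨((s * p - t * q) / (p ^ 2 + q ^ 2)) • w
        + ((s * q + t * p) / (p ^ 2 + q ^ 2)) • J x w, ?_⟩
      change f' _ = _
      rw [map_add, map_smul, map_smul, e1, e2]
      ext <;> simp <;> field_simp <;> ring
    have hrank : 1 < Module.rank ℝ (ℝ × ℝ) := by
      rw [← finrank_eq_rank, finrank_prod, finrank_self]
      norm_num
    obtain ⟨N, hN, hxN, hNΩ, hpre, hNcl⟩ := exists_isPreconnected_diff_zeros hrank hf hrange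
      (by simp [f, h1]) (h.isOpen.mem_nhds hx)
    refine ⟨N, hN, hxN, hNΩ, _, sdiff_subset, ?_, hpre, hNcl⟩
    rintro z ⟨hz, hz0⟩
    refine ⟨hNΩ hz, fun h0 ↦ hz0 ?_⟩
    simp [f, h0]
  · obtain ⟨r, hr, hball⟩ := Metric.isOpen_iff.1 h.isOpen_regular x ⟨hx, h1⟩
    exact ⟨Metric.ball x r, Metric.isOpen_ball, Metric.mem_ball_self hr,
      fun z hz ↦ (hball hz).1, _, Subset.rfl, hball, (convex_ball x r).isPreconnected,
      subset_closure⟩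

end KillingChart

end CriticalPoints

/-! ### Vector fields and connections in a chart -/

section ChartFrame
open Filter Topology Module

variable {E : Type*} [NormedAddCommGroup E] [NormedSpace ℝ E] [FiniteDimensional ℝ E]
  {M : Type*} [TopologicalSpace M] [ChartedSpace E M] [IsManifold 𝓘(ℝ, E) ∞ M]

/-- The vector field on `M` which in the chart at `y` is the vector field `F`. It is zero outside
the domain of the chart. -/
noncomputable def chartField (y : M) (F : E → E) (x : M) : TangentSpace 𝓘(ℝ, E) x :=
  (trivializationAt E (TangentSpace 𝓘(ℝ, E)) y).symmL ℝ x (F (extChartAt 𝓘(ℝ, E) y x))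

/-- The components of tangent vectors in the chart at `y`, as a linear map. It is zero outside the
domain of the chart. -/
noncomputable def chartCoord (y x : M) : TangentSpace 𝓘(ℝ, E) x →L[ℝ] E :=
  (trivializationAt E (TangentSpace 𝓘(ℝ, E)) y).continuousLinearMapAt ℝ x

/-- The tangent vector at `x` with given components in the chart at `y`, as a linear map: the
inverse of `chartCoord` over the domain of the chart, and zero outside. -/
noncomputable def chartVector (y x : M) : E →L[ℝ] TangentSpace 𝓘(ℝ, E) x :=
  (trivializationAt E (TangentSpace 𝓘(ℝ, E)) y).symmL ℝ x

lemma chartField_apply (y : M) (F : E → E) (x : M) :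
    chartField y F x = chartVector y x (F (extChartAt 𝓘(ℝ, E) y x)) := rfl

variable {y x : M} (hx : x ∈ (chartAt E y).source)
include hx

lemma chartSource_mem_nhds : (chartAt E y).source ∈ 𝓝 x :=
  (chartAt E y).open_source.mem_nhds hx

lemma chartCoord_chartVector (a : E) : chartCoord y x (chartVector y x a) = a :=
  (trivializationAt E (TangentSpace 𝓘(ℝ, E)) y).continuousLinearMapAt_symmL (R := ℝ) (by simpa) a

lemma chartVector_chartCoord (v : TangentSpace 𝓘(ℝ, E) x) :
    chartVector y x (chartCoord y x v) = v :=
  (trivializationAt E (TangentSpace 𝓘(ℝ, E)) y).symmL_continuousLinearMapAt (R := ℝ) (by simpa) v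

lemma contMDiffAt_section_iff_chartCoord {V : Π x : M, TangentSpace 𝓘(ℝ, E) x} :
    CMDiffAt ∞ (T% V) x ↔ CMDiffAt ∞ (fun z ↦ chartCoord y z (V z)) x := by
  have hb : x ∈ (trivializationAt E (TangentSpace 𝓘(ℝ, E)) y).baseSet := by simpa
  rw [(trivializationAt E (TangentSpace 𝓘(ℝ, E)) y).contMDiffAt_section_iff hb]
  refine Filter.EventuallyEq.contMDiffAt_iff ?_
  filter_upwards [chartSource_mem_nhds hx] with z hz
  simp [chartCoord, Trivialization.continuousLinearMapAt_apply, Trivialization.coe_linearMapAt, hz]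

lemma mdifferentiableAt_section_iff_chartCoord {V : Π x : M, TangentSpace 𝓘(ℝ, E) x} :
    MDiffAt (T% V) x ↔ MDiffAt (fun z ↦ chartCoord y z (V z)) x := by
  have hb : x ∈ (trivializationAt E (TangentSpace 𝓘(ℝ, E)) y).baseSet := by simpa
  rw [(trivializationAt E (TangentSpace 𝓘(ℝ, E)) y).mdifferentiableAt_section_iff _ _ hb]
  refine Filter.EventuallyEq.mdifferentiableAt_iff ?_
  filter_upwards [chartSource_mem_nhds hx] with z hz
  simp [chartCoord, Trivialization.continuousLinearMapAt_apply, Trivialization.coe_linearMapAt, hz]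

lemma chartCoord_chartField_eventuallyEq (F : E → E) :
    (fun z ↦ chartCoord y z (chartField y F z)) =ᶠ[𝓝 x] fun z ↦ F (extChartAt 𝓘(ℝ, E) y z) := by
  filter_upwards [chartSource_mem_nhds hx] with z hz
  rw [chartField_apply, chartCoord_chartVector hz]

lemma contMDiffAt_chartField {F : E → E} (hF : ContDiffAt ℝ ∞ F (extChartAt 𝓘(ℝ, E) y x)) :
    CMDiffAt ∞ (T% (chartField y F)) x := by
  rw [contMDiffAt_section_iff_chartCoord hx,
    (chartCoord_chartField_eventuallyEq hx F).contMDiffAt_iff]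
  exact hF.contMDiffAt.comp x (contMDiffAt_extChartAt' hx)

lemma mdifferentiableAt_chartField {F : E → E}
    (hF : DifferentiableAt ℝ F (extChartAt 𝓘(ℝ, E) y x)) :
    MDiffAt (T% (chartField y F)) x := by
  rw [mdifferentiableAt_section_iff_chartCoord hx,
    (chartCoord_chartField_eventuallyEq hx F).mdifferentiableAt_iff]
  exact hF.mdifferentiableAt.comp x (mdifferentiableAt_extChartAt hx)

lemma mfderiv_comp_extChartAt {F : Type*} [NormedAddCommGroup F] [NormedSpace ℝ F] {f : E → F}
    (hf : DifferentiableAt ℝ f (extChartAt 𝓘(ℝ, E) y x)) (v : TangentSpace 𝓘(ℝ, E) x) :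
    mfderiv 𝓘(ℝ, E) 𝓘(ℝ, F) (fun z ↦ f (extChartAt 𝓘(ℝ, E) y z)) x v
      = fderiv ℝ f (extChartAt 𝓘(ℝ, E) y x) (chartCoord y x v) := by
  have := mfderiv_comp x hf.mdifferentiableAt (mdifferentiableAt_extChartAt (I := 𝓘(ℝ, E)) hx)
  rw [mfderiv_eq_fderiv, ← TangentBundle.continuousLinearMapAt_trivializationAt hx] at this
  exact congrArg (fun L ↦ L v) this

omit hx in
lemma nabla_sum (nabla : CovariantDerivative 𝓘(ℝ, E) E (TangentSpace 𝓘(ℝ, E) : M → Type _))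
    {ι : Type*} (s : Finset ι) (σ : ι → Π x : M, TangentSpace 𝓘(ℝ, E) x)
    (hσ : ∀ i, MDiffAt (T% (σ i)) x) :
    nabla (fun z ↦ ∑ i ∈ s, σ i z) x = ∑ i ∈ s, nabla (σ i) x := by
  classical
  induction s using Finset.induction_on with
  | empty => exact nabla.isCovariantDerivativeOnUniv.zero
  | insert i s hi ih =>
    rw [Finset.sum_insert hi, ← ih, ← nabla.isCovariantDerivativeOnUniv.add (hσ i)
      (MDifferentiableAt.sum_section fun j _ ↦ hσ j)]
    congr 1
    ext z : 1
    simp [Finset.sum_insert hi]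

variable (nabla : CovariantDerivative 𝓘(ℝ, E) E (TangentSpace 𝓘(ℝ, E) : M → Type _))

omit hx in
lemma chartField_eq_sum {ι : Type*} [Fintype ι] (b : Basis ι ℝ E) (F : E → E) :
    chartField y F = fun x : M ↦ ∑ i,
      ((fun z ↦ b.repr (F (extChartAt 𝓘(ℝ, E) y z)) i) • chartField y fun _ ↦ b i) x := by
  ext x : 1
  conv_lhs => rw [chartField_apply, ← b.sum_repr (F _), map_sum]
  simp [chartField_apply]

/-- In a chart, the covariant derivative differs from the derivative of the components of a vector
field by a term which only depends on the value of the vector field. -/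
lemma chartCoord_nabla_chartField {F : E → E}
    (hF : DifferentiableAt ℝ F (extChartAt 𝓘(ℝ, E) y x)) (v : TangentSpace 𝓘(ℝ, E) x) :
    chartCoord y x (nabla (chartField y F) x v)
      = fderiv ℝ F (extChartAt 𝓘(ℝ, E) y x) (chartCoord y x v)
        + chartCoord y x (nabla (chartField y fun _ ↦ F (extChartAt 𝓘(ℝ, E) y x)) x v) := by
  set b := Module.finBasis ℝ E
  have hW (a : E) : MDiffAt (T% (chartField y fun _ ↦ a)) x :=
    mdifferentiableAt_chartField hx (differentiableAt_const a)
  have key (F : E → E) (hF : DifferentiableAt ℝ F (extChartAt 𝓘(ℝ, E) y x)) :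
      chartCoord y x (nabla (chartField y F) x v) =
      ∑ i, (b.repr (F (extChartAt 𝓘(ℝ, E) y x)) i •
          chartCoord y x (nabla (chartField y fun _ ↦ b i) x v)
        + b.repr (fderiv ℝ F (extChartAt 𝓘(ℝ, E) y x) (chartCoord y x v)) i • b i) := by
    have hc (i) : HasFDerivAt (fun z ↦ b.repr (F z) i)
        ((LinearMap.toContinuousLinearMap (b.coord i)).comp
          (fderiv ℝ F (extChartAt 𝓘(ℝ, E) y x))) (extChartAt 𝓘(ℝ, E) y x) :=
      ((LinearMap.toContinuousLinearMap (b.coord i)).hasFDerivAt).comp _ hF.hasFDerivAt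
    have hm (i) : MDiffAt (fun z : M ↦ b.repr (F (extChartAt 𝓘(ℝ, E) y z)) i) x :=
      (hc i).differentiableAt.mdifferentiableAt.comp x (mdifferentiableAt_extChartAt hx)
    rw [chartField_eq_sum b F, nabla_sum nabla _ _ fun i ↦ (hm i).smul_section (hW (b i)),
      _root_.sum_apply, map_sum]
    refine Finset.sum_congr rfl fun i _ ↦ ?_
    rw [nabla.isCovariantDerivativeOnUniv.leibniz (hW (b i)) (hm i)]
    have hd : mvfderiv 𝓘(ℝ, E) (fun z : M ↦ b.repr (F (extChartAt 𝓘(ℝ, E) y z)) i) x v =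
        b.repr (fderiv ℝ F (extChartAt 𝓘(ℝ, E) y x) (chartCoord y x v)) i := by
      have := mfderiv_comp_extChartAt hx (hc i).differentiableAt v
      rw [(hc i).fderiv] at this
      exact this
    rw [_root_.add_apply, _root_.smul_apply, ContinuousLinearMap.smulRight_apply, hd, map_add,
      map_smul, map_smul, chartField_apply, chartCoord_chartVector hx]
  rw [key F hF, key _ (differentiableAt_const _)]
  simp [Finset.sum_add_distrib, add_comm, b.sum_repr]

lemma mlieBracket_chartField_const (a b : E) :
    VectorField.mlieBracket 𝓘(ℝ, E) (chartField y fun _ ↦ a) (chartField y fun _ ↦ b) x = 0 := by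
  let C (a : E) : Π z : E, TangentSpace 𝓘(ℝ, E) z := fun _ ↦ a
  have e (a : E) : chartField y (fun _ ↦ a) =ᶠ[𝓝 x]
      VectorField.mpullback 𝓘(ℝ, E) 𝓘(ℝ, E) (extChartAt 𝓘(ℝ, E) y) (C a) := by
    filter_upwards [chartSource_mem_nhds hx] with z hz
    have h1 : (chartCoord y z).inverse = chartVector y z :=
      ContinuousLinearMap.inverse_eq
        (ContinuousLinearMap.ext fun v ↦ chartCoord_chartVector hz v)
        (ContinuousLinearMap.ext fun v ↦ chartVector_chartCoord hz v)
    have h2 : chartCoord y z = mfderiv 𝓘(ℝ, E) 𝓘(ℝ, E) (extChartAt 𝓘(ℝ, E) y) z :=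
      TangentBundle.continuousLinearMapAt_trivializationAt hz
    rw [h2] at h1
    exact (congrArg (fun L ↦ L a) h1).symm
  have hc (a : E) (z : E) : MDiffAt (T% (C a)) z :=
    (contMDiffAt_vectorSpace_iff_contDiffAt (𝕜 := ℝ) (n := 1)
      (V := C a).2 contDiffAt_const).mdifferentiableAt one_ne_zero
  have hle : minSmoothness ℝ 2 ≤ ∞ := by
    rw [minSmoothness_of_isRCLikeNormedField]
    exact WithTop.coe_le_coe.2 le_top
  have : IsManifold 𝓘(ℝ, E) (minSmoothness ℝ 2) M := .of_le hle
  rw [(e a).mlieBracket_vectorField_eq (e b), ← VectorField.mpullback_mlieBracket (n := ∞) (hc a _)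
    (hc b _) (contMDiffAt_extChartAt' hx) hle]
  have : VectorField.mlieBracket 𝓘(ℝ, E) (C a) (C b) (extChartAt 𝓘(ℝ, E) y x) = 0 := by
    rw [← VectorField.mlieBracketWithin_univ, VectorField.mlieBracketWithin_eq_lieBracketWithin]
    simp [VectorField.lieBracketWithin, C]
    rfl
  rw [VectorField.mpullback_apply, this, map_zero]

lemma mdifferentiableAt_chartField_const (a : E) : MDiffAt (T% (chartField y fun _ ↦ a)) x :=
  mdifferentiableAt_chartField hx (differentiableAt_const a)

omit hx in
open Classical in
/-- The Christoffel symbols of `nabla` in the chart at `y`, as a bilinear map at each point. Outside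
the domain of the chart they are zero. -/
noncomputable def christoffel (y x : M) : E →ₗ[ℝ] E →ₗ[ℝ] E :=
  if hx : x ∈ (chartAt E y).source then
    LinearMap.mk₂ ℝ (fun v w ↦
        chartCoord y x (nabla (chartField y fun _ ↦ w) x (chartVector y x v)))
      (fun v v' w ↦ by simp) (fun c v w ↦ by simp)
      (fun v w w' ↦ by
        have := nabla.isCovariantDerivativeOnUniv.add (mdifferentiableAt_chartField_const hx w)
          (mdifferentiableAt_chartField_const hx w')
        have e : (chartField y fun _ ↦ w + w' : Π x : M, TangentSpace 𝓘(ℝ, E) x)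
          = (chartField y fun _ ↦ w) + chartField y fun _ ↦ w' := by
          ext z : 1
          simp [chartField_apply]
        rw [e, this]
        simp)
      (fun c v w ↦ by
        have := nabla.isCovariantDerivativeOnUniv.smul_const c
          (mdifferentiableAt_chartField_const hx w)
        have e : (chartField y fun _ ↦ c • w : Π x : M, TangentSpace 𝓘(ℝ, E) x)
          = c • (chartField y fun _ ↦ w) := by
          ext z : 1
          simp [chartField_apply]
        rw [e, this]
        simp)
  else 0

lemma christoffel_apply (v w : E) : christoffel nabla y x v w =
    chartCoord y x (nabla (chartField y fun _ ↦ w) x (chartVector y x v)) := by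
  simp [christoffel, hx]

lemma nabla_chartField {F : E → E}
    (hF : DifferentiableAt ℝ F (extChartAt 𝓘(ℝ, E) y x)) (v : E) :
    nabla (chartField y F) x (chartVector y x v) = chartVector y x
      (fderiv ℝ F (extChartAt 𝓘(ℝ, E) y x) v
        + christoffel nabla y x v (F (extChartAt 𝓘(ℝ, E) y x))) := by
  rw [← chartVector_chartCoord hx (nabla _ x _), chartCoord_nabla_chartField hx nabla hF,
    chartCoord_chartVector hx, christoffel_apply hx]

end ChartFrame

/-! ### Reading the Kähler manifold in a chart -/

section SymmetricEndomorphism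
open Module

variable {V : Type*} [NormedAddCommGroup V] [InnerProductSpace ℝ V] [FiniteDimensional ℝ V]
  {T : V →ₗ[ℝ] V} {c : ℝ}

lemma apply_apply_of_isSymmetric (hT : T.IsSymmetric)
    (hc : ∀ d, End.HasEigenvalue T d → d = 0 ∨ d = c) (v : V) : T (T v) = c • T v := by
  have : T ∘ₗ T = c • T := by
    refine (hT.eigenvectorBasis rfl).toBasis.ext fun i ↦ ?_
    rcases hc _ (hT.hasEigenvalue_eigenvalues rfl i) with h | h
    · simp [hT.apply_eigenvectorBasis, h]
    · simp [hT.apply_eigenvectorBasis, h]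
  exact congrArg (fun L ↦ L v) this

lemma trace_of_isSymmetric (hT : T.IsSymmetric)
    (hc : ∀ d, End.HasEigenvalue T d → d = 0 ∨ d = c) {k : ℕ}
    (hk : c ≠ 0 → finrank ℝ (LinearMap.ker T) = k) :
    LinearMap.trace ℝ V T = ((finrank ℝ V : ℝ) - k) * c := by
  have h2 := apply_apply_of_isSymmetric hT hc
  by_cases h0 : c = 0
  · have : T = 0 := by
      ext v
      rw [LinearMap.zero_apply, ← inner_self_eq_zero (𝕜 := ℝ), hT, h2, h0]
      simp
    simp [this, h0]
  have hP : IsIdempotentElem (c⁻¹ • T) := by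
    ext v
    simp [h2, smul_smul, h0]
  have ht := (LinearMap.isProj_range_iff_isIdempotentElem _ |>.2 hP).trace
  have hr : LinearMap.range (c⁻¹ • T) = LinearMap.range T :=
    LinearMap.range_smul T _ (inv_ne_zero h0)
  rw [hr, map_smul, smul_eq_mul] at ht
  have := T.finrank_range_add_finrank_ker
  rw [hk h0] at this
  rw [← this]
  push_cast
  field_simp at ht
  rw [ht]
  ring

end SymmetricEndomorphism

section KillingChart
open Filter Topology Module

variable {E : Type*} [NormedAddCommGroup E] [NormedSpace ℝ E] [FiniteDimensional ℝ E]
  {M : Type*} [TopologicalSpace M] [ChartedSpace E M] [IsManifold 𝓘(ℝ, E) ∞ M]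

/-- The matrix of a field of endomorphisms in the chart at `y`. -/
noncomputable def chartEnd (y : M)
    (A : Π x : M, TangentSpace 𝓘(ℝ, E) x →L[ℝ] TangentSpace 𝓘(ℝ, E) x) (z : E) : E →L[ℝ] E :=
  chartCoord y ((extChartAt 𝓘(ℝ, E) y).symm z) ∘L A _ ∘L
    chartVector y ((extChartAt 𝓘(ℝ, E) y).symm z)

section
variable {y : M} {z : E} (hz : z ∈ (extChartAt 𝓘(ℝ, E) y).target)
include hz

lemma symm_mem_source : (extChartAt 𝓘(ℝ, E) y).symm z ∈ (chartAt E y).source := by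
  simpa using (extChartAt 𝓘(ℝ, E) y).map_target hz

lemma contDiffAt_comp_symm {F : Type*} [NormedAddCommGroup F] [NormedSpace ℝ F] {f : M → F}
    (hf : ContMDiffAt 𝓘(ℝ, E) 𝓘(ℝ, F) ∞ f ((extChartAt 𝓘(ℝ, E) y).symm z)) :
    ContDiffAt ℝ ∞ (fun z ↦ f ((extChartAt 𝓘(ℝ, E) y).symm z)) z :=
  (hf.comp z ((contMDiffOn_extChartAt_symm y).contMDiffAt
    ((isOpen_extChartAt_target y).mem_nhds hz))).contDiffAt

end

variable {A J S : Π x : M, TangentSpace 𝓘(ℝ, E) x →L[ℝ] TangentSpace 𝓘(ℝ, E) x} {y : M}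

lemma apply_chartVector {x : M} (hx : x ∈ (chartAt E y).source) (a : E) :
    A x (chartVector y x a) = chartVector y x (chartEnd y A (extChartAt 𝓘(ℝ, E) y x) a) := by
  have h : (extChartAt 𝓘(ℝ, E) y).symm (extChartAt 𝓘(ℝ, E) y x) = x :=
    (extChartAt 𝓘(ℝ, E) y).left_inv (by simpa)
  simp only [chartEnd, ContinuousLinearMap.comp_apply]
  rw [h, chartVector_chartCoord hx]

lemma apply_chartField {x : M} (hx : x ∈ (chartAt E y).source) (F : E → E) :
    A x (chartField y F x) = chartField y (fun z ↦ chartEnd y A z (F z)) x :=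
  apply_chartVector hx _

lemma contDiffOn_chartEnd (hA : IsSmoothEndField A) :
    ContDiffOn ℝ ∞ (chartEnd y A) (extChartAt 𝓘(ℝ, E) y).target := by
  rw [contDiffOn_clm_apply]
  intro a z hz
  have hx := symm_mem_source hz
  have h1 := (hA.contMDiffAt (x := (extChartAt 𝓘(ℝ, E) y).symm z)).clm_bundle_apply
    (contMDiffAt_chartField hx (F := fun _ ↦ a) contDiffAt_const)
  exact (contDiffAt_comp_symm hz
    ((contMDiffAt_section_iff_chartCoord hx).1 h1)).contDiffWithinAt

variable (nabla : CovariantDerivative 𝓘(ℝ, E) E (TangentSpace 𝓘(ℝ, E) : M → Type _))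

lemma covDerivEnd_chartField (hA : IsSmoothEndField A) {x : M} (hx : x ∈ (chartAt E y).source)
    (v a : E) : covDerivEnd nabla A x (chartVector y x v) (chartField y fun _ ↦ a) =
      chartVector y x (fderiv ℝ (chartEnd y A) (extChartAt 𝓘(ℝ, E) y x) v a
        + christoffel nabla y x v (chartEnd y A (extChartAt 𝓘(ℝ, E) y x) a)
        - chartEnd y A (extChartAt 𝓘(ℝ, E) y x) (christoffel nabla y x v a)) := by
  have hz : extChartAt 𝓘(ℝ, E) y x ∈ (extChartAt 𝓘(ℝ, E) y).target :=
    (extChartAt 𝓘(ℝ, E) y).map_source (by simpa)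
  have hd : DifferentiableAt ℝ (chartEnd y A) (extChartAt 𝓘(ℝ, E) y x) :=
    ((contDiffOn_chartEnd hA).contDiffAt
      ((isOpen_extChartAt_target y).mem_nhds hz)).differentiableAt (by simp)
  have hda : DifferentiableAt ℝ (fun z ↦ chartEnd y A z a) (extChartAt 𝓘(ℝ, E) y x) :=
    hd.clm_apply (differentiableAt_const a)
  have e : ∀ᶠ x in 𝓝 x, A x (chartField y (fun _ ↦ a) x)
      = chartField y (fun z ↦ chartEnd y A z a) x := by
    filter_upwards [chartSource_mem_nhds hx] with x hx using apply_chartField hx _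
  have h1 : MDiffAt (T% fun x ↦ A x (chartField y (fun _ ↦ a) x)) x :=
    ((hA.contMDiffAt (x := x)).clm_bundle_apply
      (contMDiffAt_chartField hx (F := fun _ ↦ a) contDiffAt_const)).mdifferentiableAt (by simp)
  rw [covDerivEnd, nabla.isCovariantDerivativeOnUniv.congr_of_eventuallyEq h1
    (mdifferentiableAt_chartField hx hda) univ_mem e, nabla_chartField hx nabla hda,
    nabla_chartField hx nabla (differentiableAt_const a), apply_chartVector hx, ← map_sub,
    fderiv_clm_apply_apply hd (differentiableAt_const a)]
  simp

lemma exists_extChartAt_eq {z : E} (hz : z ∈ (extChartAt 𝓘(ℝ, E) y).target) :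
    ∃ x ∈ (chartAt E y).source, extChartAt 𝓘(ℝ, E) y x = z :=
  ⟨_, by simpa using (extChartAt 𝓘(ℝ, E) y).map_target hz, (extChartAt 𝓘(ℝ, E) y).right_inv hz⟩

/-- The components of tangent vectors in the chart at `y`, as a linear equivalence. -/
noncomputable def chartCoordEquiv {x : M} (hx : x ∈ (chartAt E y).source) :
    TangentSpace 𝓘(ℝ, E) x ≃ₗ[ℝ] E :=
  { (chartCoord (E := E) y x).toLinearMap with
    invFun := chartVector y x
    left_inv := chartVector_chartCoord hx
    right_inv := chartCoord_chartVector hx }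

lemma chartEnd_eq_conj {x : M} (hx : x ∈ (chartAt E y).source) :
    (chartEnd y A (extChartAt 𝓘(ℝ, E) y x) : E →ₗ[ℝ] E) = (chartCoordEquiv hx).conj (A x) := by
  ext a
  change _ = chartCoord y x (A x (chartVector y x a))
  rw [apply_chartVector hx, chartCoord_chartVector hx]
  rfl

variable [RiemannianBundle (fun x : M ↦ TangentSpace 𝓘(ℝ, E) x)]
  [IsContMDiffRiemannianBundle 𝓘(ℝ, E) ∞ E (fun x : M ↦ TangentSpace 𝓘(ℝ, E) x)]

/-- The metric in the chart at `y`, as a bilinear form on the model space at each point. -/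
noncomputable def chartMetric (y : M) (z : E) : E →L[ℝ] E →L[ℝ] ℝ :=
  (innerSL ℝ (E := TangentSpace 𝓘(ℝ, E) ((extChartAt 𝓘(ℝ, E) y).symm z))).bilinearComp
    (chartVector y _) (chartVector y _)

lemma chartMetric_apply {x : M} (hx : x ∈ (chartAt E y).source) (a b : E) :
    chartMetric y (extChartAt 𝓘(ℝ, E) y x) a b
      = inner ℝ (chartVector y x a) (chartVector y x b) := by
  have h : (extChartAt 𝓘(ℝ, E) y).symm (extChartAt 𝓘(ℝ, E) y x) = x :=
    (extChartAt 𝓘(ℝ, E) y).left_inv (by simpa)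
  simp only [chartMetric, ContinuousLinearMap.bilinearComp_apply, innerSL_apply_apply]
  rw [h]

lemma contDiffOn_chartMetric :
    ContDiffOn ℝ ∞ (chartMetric y) (extChartAt 𝓘(ℝ, E) y).target := by
  rw [contDiffOn_clm_apply]
  intro a
  rw [contDiffOn_clm_apply]
  intro b z hz
  have hx := symm_mem_source hz
  have hW (a : E) : CMDiffAt ∞ (T% (chartField y fun _ ↦ a)) ((extChartAt 𝓘(ℝ, E) y).symm z) :=
    contMDiffAt_chartField hx contDiffAt_const
  have h := ContMDiffAt.inner_bundle (E := fun x : M ↦ TangentSpace 𝓘(ℝ, E) x) (hW a) (hW b)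
  exact (contDiffAt_comp_symm hz h).contDiffWithinAt

/-- The data of a `J`-invariant Killing tensor on a Kähler manifold, read in a chart. -/
lemma killingChart (h2 : 2 < finrank ℝ E) (h_nabla : IsLeviCivita nabla) (hJ : IsKahler nabla J)
    (hS : IsKillingTensor nabla S) (hSJ : ∀ x v, S x (J x v) = J x (S x v)) {μ : M → ℝ} {m : ℕ}
    (hμ : HasEigenvaluesZeroAnd S μ m) (y : M) :
    KillingChart (extChartAt 𝓘(ℝ, E) y).target (chartMetric y) (chartEnd y J) (chartEnd y S)
      (fun z ↦ μ ((extChartAt 𝓘(ℝ, E) y).symm z))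
      (fun z ↦ christoffel nabla y ((extChartAt 𝓘(ℝ, E) y).symm z)) := by
  have left_inv {x : M} (hx : x ∈ (chartAt E y).source) :
      (extChartAt 𝓘(ℝ, E) y).symm (extChartAt 𝓘(ℝ, E) y x) = x :=
    (extChartAt 𝓘(ℝ, E) y).left_inv (by simpa)
  have hfin (x : M) : FiniteDimensional ℝ (TangentSpace 𝓘(ℝ, E) x) :=
    inferInstanceAs (FiniteDimensional ℝ E)
  have inj {x : M} (hx : x ∈ (chartAt E y).source) := (chartCoordEquiv hx).symm.injective
  have hsymm (x : M) : (S x : TangentSpace 𝓘(ℝ, E) x →ₗ[ℝ] TangentSpace 𝓘(ℝ, E) x).IsSymmetric :=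
    hS.symm x
  have hmem {x : M} (hx : x ∈ (chartAt E y).source) :
      extChartAt 𝓘(ℝ, E) y x ∈ (extChartAt 𝓘(ℝ, E) y).target :=
    (extChartAt 𝓘(ℝ, E) y).map_source (by simpa)
  have hdiff {x : M} (hx : x ∈ (chartAt E y).source) {F : Type _} [NormedAddCommGroup F]
      [NormedSpace ℝ F] {f : E → F} (hf : ContDiffOn ℝ ∞ f (extChartAt 𝓘(ℝ, E) y).target) :
      DifferentiableAt ℝ f (extChartAt 𝓘(ℝ, E) y x) :=
    (hf.contDiffAt ((isOpen_extChartAt_target y).mem_nhds (hmem hx))).differentiableAt (by simp)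
  refine ⟨isOpen_extChartAt_target y, h2, contDiffOn_chartMetric, contDiffOn_chartEnd hJ.smooth,
    contDiffOn_chartEnd hS.smooth, ?_, ?_, ?_, ?_, ?_, ?_, ?_, ?_, ?_, ?_, ?_, ?_, ?_⟩ <;>
    intro z hz <;> obtain ⟨x, hx, rfl⟩ := exists_extChartAt_eq hz <;>
    try rw [left_inv hx]
  · intro v w
    rw [chartMetric_apply hx, chartMetric_apply hx, real_inner_comm]
  · intro v hv
    rw [chartMetric_apply hx]
    exact real_inner_self_pos.2 fun h ↦ hv (inj hx (h.trans (map_zero _).symm))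
  · refine fun v ↦ inj hx ?_
    change chartVector y x _ = chartVector y x _
    rw [← apply_chartVector hx, ← apply_chartVector hx, hJ.sq, map_neg]
  · intro v w
    rw [chartMetric_apply hx, chartMetric_apply hx, ← apply_chartVector hx,
      ← apply_chartVector hx, hJ.orthogonal]
  · intro v w
    rw [chartMetric_apply hx, chartMetric_apply hx, ← apply_chartVector hx,
      ← apply_chartVector hx, hS.symm]
  · refine fun v ↦ inj hx ?_
    change chartVector y x _ = chartVector y x _
    rw [← apply_chartVector hx, ← apply_chartVector hx, ← apply_chartVector hx,
      ← apply_chartVector hx, hSJ]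
  · refine fun v ↦ inj hx ?_
    change chartVector y x _ = chartVector y x _
    rw [map_smul, ← apply_chartVector hx, ← apply_chartVector hx]
    exact apply_apply_of_isSymmetric (hsymm x) (hμ.eigenvalue x) _
  · rw [chartEnd_eq_conj hx, LinearMap.trace_conj', ← (chartCoordEquiv hx).finrank_eq]
    exact_mod_cast trace_of_isSymmetric (hsymm x) (hμ.eigenvalue x) (hμ.finrank_ker x)
  · intro h0
    rw [← hμ.finrank_ker x h0, chartEnd_eq_conj hx, LinearEquiv.conj_apply,
      LinearMap.ker_comp, LinearEquiv.ker_comp, Submodule.comap_equiv_eq_map_symm]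
    exact LinearEquiv.finrank_map_eq _ _
  · intro v w
    have h := h_nabla.torsion_eq_zero x _ _ (mdifferentiableAt_chartField_const hx v)
      (mdifferentiableAt_chartField_const hx w)
    -- coordinate fields commute, so vanishing torsion is the symmetry of the Christoffel symbols
    rw [mlieBracket_chartField_const hx, sub_eq_zero] at h
    rw [christoffel_apply hx, christoffel_apply hx]
    exact congrArg _ h
  · intro v a b
    have h := h_nabla.metric x (chartVector y x v) _ _ (mdifferentiableAt_chartField_const hx a)
      (mdifferentiableAt_chartField_const hx b)
    rw [nabla_chartField hx nabla (differentiableAt_const _),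
      nabla_chartField hx nabla (differentiableAt_const _)] at h
    simp only [chartField_apply, ← chartMetric_apply hx, fderiv_fun_const, Pi.zero_apply,
      _root_.zero_apply, zero_add] at h
    rw [← h]
    have hg := hdiff hx (contDiffOn_chartMetric (y := y))
    have e : (fun x : M ↦ (inner ℝ (chartVector y x a) (chartVector y x b) : ℝ)) =ᶠ[𝓝 x]
        fun x ↦ chartMetric y (extChartAt 𝓘(ℝ, E) y x) a b := by
      filter_upwards [chartSource_mem_nhds hx] with x hx using (chartMetric_apply hx a b).symm
    have hc (c : E) : DifferentiableAt ℝ (fun _ : E ↦ c) (extChartAt 𝓘(ℝ, E) y x) :=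
      differentiableAt_const c
    rw [e.mfderiv_eq]
    refine Eq.trans ?_ (mfderiv_comp_extChartAt hx (f := fun z ↦ chartMetric y z a b)
      ((hg.clm_apply (hc a)).clm_apply (hc b)) _).symm
    rw [chartCoord_chartVector hx, fderiv_clm_apply_apply (hg.clm_apply (hc a)) (hc b),
      fderiv_clm_apply_apply hg (hc a)]
    simp
  · intro v a
    have h := hJ.parallel x (chartVector y x v) _ (mdifferentiableAt_chartField_const hx a)
    rw [covDerivEnd_chartField nabla hJ.smooth hx] at h
    have := inj hx (h.trans (map_zero _).symm)
    rw [sub_eq_zero, ← eq_sub_iff_add_eq] at this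
    exact this
  · intro u v w
    have h := hS.cyclic x _ _ _ (mdifferentiableAt_chartField_const hx u)
      (mdifferentiableAt_chartField_const hx v) (mdifferentiableAt_chartField_const hx w)
    simp only [chartField_apply (M := M) y (fun _ ↦ _) x] at h
    rw [covDerivEnd_chartField nabla hS.smooth hx, covDerivEnd_chartField nabla hS.smooth hx,
      covDerivEnd_chartField nabla hS.smooth hx] at h
    simpa only [← chartMetric_apply hx] using h

end KillingChart

/-! ### Connectedness and density -/

section Connectedness
open Filter Topology Module

/-- A nonempty subset `V` of a connected space is connected and dense if each point of its
closure has a neighbourhood in which a connected part of `V` is dense. -/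
lemma isConnected_and_dense_of_locally {X : Type*} [TopologicalSpace X] [PreconnectedSpace X]
    {V : Set X} (hne : V.Nonempty)
    (hloc : ∀ y ∈ closure V, ∃ N, IsOpen N ∧ y ∈ N ∧ ∃ W ⊆ V, IsPreconnected W ∧ N ⊆ closure W) :
    IsConnected V ∧ Dense V := by
  have hcl : closure V = univ := by
    refine IsClopen.eq_univ ⟨isClosed_closure, isOpen_iff_mem_nhds.2 fun y hy ↦ ?_⟩ hne.closure
    obtain ⟨N, hN, hyN, W, hWV, -, hNW⟩ := hloc y hy
    exact mem_of_superset (hN.mem_nhds hyN) (hNW.trans (closure_mono hWV))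
  refine ⟨⟨hne, fun u v hu hv hVuv hVu hVv ↦ ?_⟩, dense_iff_closure_eq.2 hcl⟩
  have hcover : univ ⊆ closure (V ∩ u) ∪ closure (V ∩ v) := by
    rw [← closure_union, ← inter_union_distrib_left, inter_eq_self_of_subset_left hVuv, hcl]
  obtain ⟨y, -, hyu, hyv⟩ := isPreconnected_closed_iff.1 isPreconnected_univ _ _ isClosed_closure
    isClosed_closure hcover (by simpa using hVu.closure) (by simpa using hVv.closure)
  obtain ⟨N, hN, hyN, W, hWV, hW, hNW⟩ := hloc y (closure_mono inter_subset_left hyu)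
  -- both parts of `V` accumulate at `y`, hence meet `N`, hence meet its dense subset `W`
  have meets {u : Set X} (hu : IsOpen u) (hyu : y ∈ closure (V ∩ u)) : (W ∩ u).Nonempty := by
    obtain ⟨a, haN, haV, hau⟩ := mem_closure_iff.1 hyu N hN hyN
    obtain ⟨b, hbu, hbW⟩ := mem_closure_iff.1 (hNW haN) u hu hau
    exact ⟨b, hbW, hbu⟩
  exact (hW u v hu hv (hWV.trans hVuv) (meets hu hyu) (meets hv hyv)).mono
    (inter_subset_inter_left _ hWV)

variable {E : Type*} [NormedAddCommGroup E] [NormedSpace ℝ E] [FiniteDimensional ℝ E]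
  {M : Type*} [TopologicalSpace M] [ChartedSpace E M] [IsManifold 𝓘(ℝ, E) ∞ M] {y : M}
  {g : E → E →L[ℝ] E →L[ℝ] ℝ} {J S : E → E →L[ℝ] E} {μ : M → ℝ}
  {Γ : E → E →ₗ[ℝ] E →ₗ[ℝ] E}
  (h : KillingChart (extChartAt 𝓘(ℝ, E) y).target g J S
    (fun z ↦ μ ((extChartAt 𝓘(ℝ, E) y).symm z)) Γ)
include h

lemma mem_regularSet_iff {x : M} (hx : x ∈ (chartAt E y).source) :
    x ∈ regularSet 𝓘(ℝ, E) μ ↔ extChartAt 𝓘(ℝ, E) y x ∈ {z ∈ (extChartAt 𝓘(ℝ, E) y).target |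
      fderiv ℝ (fun z ↦ μ ((extChartAt 𝓘(ℝ, E) y).symm z)) z ≠ 0} := by
  have left_inv {x : M} (hx : x ∈ (chartAt E y).source) :
      (extChartAt 𝓘(ℝ, E) y).symm (extChartAt 𝓘(ℝ, E) y x) = x :=
    (extChartAt 𝓘(ℝ, E) y).left_inv (by simpa)
  have hz : extChartAt 𝓘(ℝ, E) y x ∈ (extChartAt 𝓘(ℝ, E) y).target :=
    (extChartAt 𝓘(ℝ, E) y).map_source (by simpa)
  have e : μ =ᶠ[𝓝 x]
      fun x ↦ μ ((extChartAt 𝓘(ℝ, E) y).symm (extChartAt 𝓘(ℝ, E) y x)) := by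
    filter_upwards [chartSource_mem_nhds hx] with x hx using congrArg μ (left_inv hx).symm
  have hm (v : TangentSpace 𝓘(ℝ, E) x) : mfderiv 𝓘(ℝ, E) 𝓘(ℝ) μ x v = fderiv ℝ
      (fun z ↦ μ ((extChartAt 𝓘(ℝ, E) y).symm z)) (extChartAt 𝓘(ℝ, E) y x) (chartCoord y x v) := by
    rw [e.mfderiv_eq]
    exact mfderiv_comp_extChartAt hx (h.diff_mu hz) v
  have hiff : mfderiv 𝓘(ℝ, E) 𝓘(ℝ) μ x = 0 ↔ fderiv ℝ
      (fun z ↦ μ ((extChartAt 𝓘(ℝ, E) y).symm z)) (extChartAt 𝓘(ℝ, E) y x) = 0 := by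
    refine ⟨fun h0 ↦ ?_, fun h0 ↦ ?_⟩
    · ext a
      rw [← chartCoord_chartVector hx a, ← hm, h0]
      rfl
    · ext v
      rw [hm, h0]
      rfl
  refine ⟨fun hreg ↦ ⟨hz, fun h0 ↦ hreg.2 (hiff.2 h0)⟩,
    fun hreg ↦ ⟨?_, fun h0 ↦ hreg.2 (hiff.1 h0)⟩⟩
  have := h.mu_ne_zero hz hreg.2
  rwa [left_inv hx] at this

lemma exists_isPreconnected_regularSet (hy : y ∈ closure (regularSet 𝓘(ℝ, E) μ)) :
    ∃ N, IsOpen N ∧ y ∈ N ∧ ∃ W ⊆ regularSet 𝓘(ℝ, E) μ, IsPreconnected W ∧ N ⊆ closure W := by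
  have hys := mem_chart_source E y
  have hcl : extChartAt 𝓘(ℝ, E) y y ∈ closure {z ∈ (extChartAt 𝓘(ℝ, E) y).target |
      fderiv ℝ (fun z ↦ μ ((extChartAt 𝓘(ℝ, E) y).symm z)) z ≠ 0} := by
    rw [mem_closure_iff_frequently] at hy ⊢
    refine (continuousAt_extChartAt (I := 𝓘(ℝ, E)) y).frequently
      ((hy.and_eventually (chartSource_mem_nhds hys)).mono fun x hx ↦ ?_)
    exact (mem_regularSet_iff h hx.2).1 hx.1
  obtain ⟨N, hN, hyN, hNt, W, hWN, hWreg, hW, hNW⟩ :=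
    h.exists_isPreconnected_regular (mem_extChartAt_target y) hcl
  refine ⟨(chartAt E y).source ∩ extChartAt 𝓘(ℝ, E) y ⁻¹' N, ?_, ⟨hys, hyN⟩,
    (extChartAt 𝓘(ℝ, E) y).symm '' W, ?_, ?_, ?_⟩
  · rw [← extChartAt_source 𝓘(ℝ, E)]
    exact isOpen_extChartAt_preimage' y hN
  · rintro _ ⟨z, hz, rfl⟩
    obtain ⟨x, hx, rfl⟩ := exists_extChartAt_eq (hWreg hz).1
    rw [(extChartAt 𝓘(ℝ, E) y).left_inv (by simpa)]
    exact (mem_regularSet_iff h hx).2 (hWreg hz)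
  · exact hW.image _ ((continuousOn_extChartAt_symm y).mono fun z hz ↦ (hWreg hz).1)
  · rintro x ⟨hx, hxN⟩
    rw [← (extChartAt 𝓘(ℝ, E) y).left_inv (x := x) (by simpa)]
    exact mem_closure_image (continuousAt_extChartAt_symm'' (hNt hxN)) (hNW hxN)

lemma eventually_eq_of_regularSet_eq_empty (he : regularSet 𝓘(ℝ, E) μ = ∅) :
    ∀ᶠ x in 𝓝 y, μ x = μ y := by
  obtain ⟨r, hr, hball⟩ := Metric.isOpen_iff.1 h.isOpen _ (mem_extChartAt_target (I := 𝓘(ℝ, E)) y)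
  have hzero : ∀ z ∈ (extChartAt 𝓘(ℝ, E) y).target,
      fderiv ℝ (fun z ↦ μ ((extChartAt 𝓘(ℝ, E) y).symm z)) z = 0 := by
    intro z hz
    obtain ⟨x, hx, rfl⟩ := exists_extChartAt_eq hz
    by_contra h0
    have := (mem_regularSet_iff h hx).2 ⟨hz, h0⟩
    simp [he] at this
  filter_upwards [chartSource_mem_nhds (mem_chart_source E y),
    (continuousAt_extChartAt (I := 𝓘(ℝ, E)) y) (Metric.ball_mem_nhds _ hr)] with x hx hxb
  have := Metric.isOpen_ball.is_const_of_fderiv_eq_zero (convex_ball _ r).isPreconnected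
    (fun z hz ↦ (h.diff_mu (hball hz)).differentiableWithinAt) (fun z hz ↦ hzero z (hball hz))
    hxb (Metric.mem_ball_self hr)
  rwa [(extChartAt 𝓘(ℝ, E) y).left_inv (by simpa), extChartAt_to_inv] at this

end Connectedness

end KahlerKilling

theorem proposition4p1 (n : ℕ) (hn : 2 ≤ n)
    {M : Type*} [TopologicalSpace M] [ChartedSpace (EuclideanSpace ℝ (Fin (2 * n))) M]
    [IsManifold (𝓡 (2 * n)) ∞ M] [T2Space M] [CompactSpace M] [ConnectedSpace M]
    [RiemannianBundle (fun x : M ↦ TangentSpace (𝓡 (2 * n)) x)]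
    [IsContMDiffRiemannianBundle (𝓡 (2 * n)) ∞ (EuclideanSpace ℝ (Fin (2 * n)))
      (fun x : M ↦ TangentSpace (𝓡 (2 * n)) x)]
    (nabla : CovariantDerivative (𝓡 (2 * n)) (EuclideanSpace ℝ (Fin (2 * n)))
      (TangentSpace (𝓡 (2 * n)) : M → Type _))
    (h_nabla : KahlerKilling.IsLeviCivita nabla)
    (J : Π x : M, TangentSpace (𝓡 (2 * n)) x →L[ℝ] TangentSpace (𝓡 (2 * n)) x)
    (hJ : KahlerKilling.IsKahler nabla J)
    (S : Π x : M, TangentSpace (𝓡 (2 * n)) x →L[ℝ] TangentSpace (𝓡 (2 * n)) x)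
    (hS : KahlerKilling.IsKillingTensor nabla S)
    (hSJ : ∀ (x : M) (v : TangentSpace (𝓡 (2 * n)) x), S x (J x v) = J x (S x v))
    (μ : M → ℝ) (hμ : KahlerKilling.HasEigenvaluesZeroAnd S μ (2 * n - 2))
    (hμ_nonconst : ∃ x y : M, μ x ≠ μ y) :
    IsConnected (KahlerKilling.regularSet (𝓡 (2 * n)) μ) ∧
      interior (KahlerKilling.regularSet (𝓡 (2 * n)) μ)ᶜ = ∅ := by
  have h2 : 2 < Module.finrank ℝ (EuclideanSpace ℝ (Fin (2 * n))) := by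
    rw [finrank_euclideanSpace_fin]
    omega
  have chart (y : M) := KahlerKilling.killingChart nabla h2 h_nabla hJ hS hSJ hμ y
  rw [interior_eq_empty_iff_dense_compl, compl_compl]
  refine KahlerKilling.isConnected_and_dense_of_locally ?_ fun y hy ↦
    KahlerKilling.exists_isPreconnected_regularSet (chart y) hy
  by_contra hempty
  rw [not_nonempty_iff_eq_empty] at hempty
  obtain ⟨x, y, hxy⟩ := hμ_nonconst
  exact hxy (((IsLocallyConstant.iff_eventually_eq μ).2 fun y ↦
    KahlerKilling.eventually_eq_of_regularSet_eq_empty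
      (chart y) hempty).apply_eq_of_preconnectedSpace x y)
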